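/- Let $m\ge 1$ and let $\boldsymbol n=(n_1,\dots,n_m)$ be nonnegative integers, $N=n_1+\cdots+n_m$; cut $\{1,\dots,N\}$ into consecutive boxes $S_1,\dots,S_m$ with $|S_j|=n_j$. A set partition of $\{1,\dots,N\}$ is \emph{inhomogeneous} if each block has at least two elements and no two elements of a block lie in the same box; let $\mathcal P(\boldsymbol n)$ be the set of these. For a set partition $\pi$ let $\mathrm{bl}(\pi)$ be the number of blocks, $\mathrm{sg}(\pi)$ the number of blocks of size one, $\mathrm{tr}(\pi)$ the number of elements that are neither the least nor the greatest element of their block, and $\mathrm{cr}(\pi)$ the number of pairs of arcs $(i,j),(k,\ell)$ with $i<k<j<\ell$, an arc being a pair $i<j$ of successive elements of a block. Put $$\mathcal F(\boldsymbol n|q)=\sum_{\pi\in\mathcal P(\boldsymbol n)}a^{\mathrm{bl}(\pi)}b^{\mathrm{tr}(\pi)}c^{\mathrm{sg}(\pi)}q^{\mathrm{cr}(\pi)}$$ (here $\mathrm{sg}(\pi)=0$ for every $\pi\in\mathcal P(\boldsymbol n)$). With $[n]_q=1+q+\cdots+q^{n-1}$, the $q$-Charlier polynomials $C_n(x|q)=C_n(x,a,b,c|q)$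 are defined by $C_{-1}(x|q)=0$, $C_0(x|q)=1$ and $$C_{n+1}(x|q)=(x-c-b[n]_q)\,C_n(x|q)-a[n]_q\,C_{n-1}(x|q)\qquad(n\ge 0).$$ (i) Let $R$ be a commutative ring and $a,b,c,q\in R$. There is exactly one $R$-linear functional $\mathcal L:R[x]\to R$ with $\mathcal L(1)=1$ and $\mathcal L(C_iC_j)=0$ for all $i\ne j$, and it satisfies $$\mathcal F(\boldsymbol n|q)=\mathcal L\bigl(C_{n_1}(x|q)\cdots C_{n_m}(x|q)\bigr).$$ (ii) Let $a,b,c,q$ be real with $a>0$, $-1<q<1$ and $b^2\le a(1-q)$. Then $$\mathcal F(\boldsymbol n|q)=\mathcal L_1\bigl(C_{n_1}(x|q)\cdots C_{n_m}(x|q)\bigr),$$ where $$\mathcal L_1(f)=\frac{(q;q)_\infty}{2\pi}\,\frac12\sqrt{\frac{1-q}{a}}\int_{A_-}^{A_+}f(x)\prod_{k=0}^\infty\frac{1-2u_1(x)q^k+q^{2k}}{1+2b\,v_1(x)q^k/\sqrt{a(1-q)}+b^2q^{2k}/(a(1-q))}\,\frac{dx}{\sqrt{1-v_1(x)^2}},$$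 $$(q;q)_\infty=\prod_{k\ge1}(1-q^k),\qquad A_\pm=c+\frac b{1-q}\pm2\sqrt{\frac a{1-q}},\qquad v_1(x)=\frac12\sqrt{\frac{1-q}{a}}\Bigl(x-c-\frac b{1-q}\Bigr),$$ $$u_1(x)=\frac{1-q}{2a}x^2-\frac{c(1-q)+b}{a}x+\frac{b^2+c^2(1-q)^2+2(1-q)(bc-a)}{2a(1-q)},$$ and for every polynomial $f$ the integral converges absolutely. -/

import Mathlib

open scoped BigOperators

/-! ### Set partitions of `{0, …, N - 1}` and their statistics -/

namespace QCharlier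

/-- A set partition of the `N`-element ordered set `Fin N`. -/
abbrev SetPartition (N : ℕ) : Type := Finpartition (Finset.univ : Finset (Fin N))

/-- `i < j` are successive elements of a block of `π`: the pair `(i, j)` is an arc of `π`. -/
def IsArc {N : ℕ} (π : SetPartition N) (i j : Fin N) : Prop :=
  i < j ∧ ∃ B ∈ π.parts, i ∈ B ∧ j ∈ B ∧ ∀ p ∈ B, ¬ (i < p ∧ p < j)

instance {N : ℕ} (π : SetPartition N) (i j : Fin N) : Decidable (IsArc π i j) := by
  unfold IsArc; infer_instance

/-- The number of blocks. -/
def bl {N : ℕ} (π : SetPartition N) : ℕ := π.parts.card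

/-- The number of singletons, i.e. blocks of size one. -/
def sg {N : ℕ} (π : SetPartition N) : ℕ := (π.parts.filter fun B => B.card = 1).card

/-- The number of transients: elements that are neither the least nor the greatest element of
their block. -/
def tr {N : ℕ} (π : SetPartition N) : ℕ :=
  (Finset.univ.filter fun x : Fin N =>
    ∃ B ∈ π.parts, x ∈ B ∧ (∃ y ∈ B, y < x) ∧ (∃ z ∈ B, x < z)).card

/-- The number of arc crossings: pairs of arcs `(i, j)`, `(k, l)` with `i < k < j < l`. -/
def cr {N : ℕ} (π : SetPartition N) : ℕ :=
  (Finset.univ.filter fun e : (Fin N × Fin N) × (Fin N × Fin N) =>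
    IsArc π e.1.1 e.1.2 ∧ IsArc π e.2.1 e.2.2 ∧
      e.1.1 < e.2.1 ∧ e.2.1 < e.1.2 ∧ e.1.2 < e.2.2).card

/-- The weight `a ^ bl * b ^ tr * c ^ sg * q ^ cr` of a set partition. -/
def weight {R : Type*} [CommRing R] (a b c q : R) {N : ℕ} (π : SetPartition N) : R :=
  a ^ bl π * b ^ tr π * c ^ sg π * q ^ cr π

/-! ### Boxes and inhomogeneous partitions -/

/-- The `j`-th box: `n_1 + ⋯ + n_m` elements are cut into consecutive boxes of sizes
`n_1, …, n_m` (all indices start at zero). -/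
def box {m : ℕ} (n : Fin m → ℕ) (j : Fin m) : Finset (Fin (∑ i, n i)) :=
  Finset.univ.filter fun x =>
    ∑ i ∈ Finset.Iio j, n i ≤ (x : ℕ) ∧ (x : ℕ) < ∑ i ∈ Finset.Iic j, n i

/-- Every block has at least two elements, and no two elements of a block share a box. -/
def IsInhomogeneous {m : ℕ} (n : Fin m → ℕ) (π : SetPartition (∑ i, n i)) : Prop :=
  ∀ B ∈ π.parts, 2 ≤ B.card ∧
    ∀ x ∈ B, ∀ y ∈ B, x ≠ y → ∀ j, ¬ (x ∈ box n j ∧ y ∈ box n j)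

instance {m : ℕ} (n : Fin m → ℕ) : DecidablePred (IsInhomogeneous n) := fun π => by
  unfold IsInhomogeneous; infer_instance

/-- The enumerative polynomial `F(n; a, b, c | q)` of inhomogeneous partitions. -/
def F {R : Type*} [CommRing R] (a b c q : R) {m : ℕ} (n : Fin m → ℕ) : R :=
  ∑ π : SetPartition (∑ i, n i) with IsInhomogeneous n π, weight a b c q π

/-! ### `q`-Charlier polynomials -/

/-- The `q`-integer `[n]_q = 1 + q + ⋯ + q ^ (n - 1)`. -/
def qInt {R : Type*} [CommRing R] (q : R) (n : ℕ) : R := ∑ i ∈ Finset.range n, q ^ i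

/-- The `q`-Charlier polynomials:
`C_{n+1} = (x - c - b [n]_q) C_n - a [n]_q C_{n-1}`, `C_0 = 1`, `C_{-1} = 0`. -/
noncomputable def charlier {R : Type*} [CommRing R] (a b c q : R) : ℕ → Polynomial R
  | 0 => 1
  | 1 => Polynomial.X - Polynomial.C c
  | n + 2 =>
      (Polynomial.X - Polynomial.C c - Polynomial.C (b * qInt q (n + 1)))
          * charlier a b c q (n + 1)
        - Polynomial.C (a * qInt q (n + 1)) * charlier a b c q n

/-- `L` is the (normalized) linear functional for which the `q`-Charlier polynomials are
orthogonal. -/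
def IsOrthogonalityFunctional {R : Type*} [CommRing R] (a b c q : R)
    (L : Polynomial R →ₗ[R] R) : Prop :=
  L 1 = 1 ∧ ∀ i j : ℕ, i ≠ j → L (charlier a b c q i * charlier a b c q j) = 0

/-! ### The integral form of the functional -/

/-- `(q; q)_∞`. -/
noncomputable def qPochInf (q : ℝ) : ℝ := ∏' k : ℕ, (1 - q ^ (k + 1))

/-- The quadratic polynomial `u_1`. -/
noncomputable def u₁ (a b c q x : ℝ) : ℝ :=
  (1 - q) / (2 * a) * x ^ 2 - (c * (1 - q) + b) / a * x
    + (b ^ 2 + c ^ 2 * (1 - q) ^ 2 + 2 * (1 - q) * (b * c - a)) / (2 * a * (1 - q))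

/-- The affine function `v_1`. -/
noncomputable def v₁ (a b c q x : ℝ) : ℝ :=
  1 / 2 * √((1 - q) / a) * (x - c - b / (1 - q))

/-- The density of the orthogonality measure of the `q`-Charlier polynomials. -/
noncomputable def density (a b c q x : ℝ) : ℝ :=
  qPochInf q / (2 * Real.pi) * (1 / 2) * √((1 - q) / a)
    * (∏' k : ℕ, (1 - 2 * u₁ a b c q x * q ^ k + q ^ (2 * k))
        / (1 + 2 * b * v₁ a b c q x * q ^ k / √(a * (1 - q))
            + b ^ 2 * q ^ (2 * k) / (a * (1 - q))))
    / √(1 - v₁ a b c q x ^ 2)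

/-- The left end `A₋` of the support. -/
noncomputable def Aminus (a b c q : ℝ) : ℝ := c + b / (1 - q) - 2 * √(a / (1 - q))

/-- The right end `A₊` of the support. -/
noncomputable def Aplus (a b c q : ℝ) : ℝ := c + b / (1 - q) + 2 * √(a / (1 - q))

/-- The functional `L_1`, as an integral over `[A₋, A₊]`. -/
noncomputable def L₁ (a b c q : ℝ) (f : ℝ → ℝ) : ℝ :=
  ∫ x in (Aminus a b c q)..(Aplus a b c q), f x * density a b c q x

end QCharlier

/-!
Read a set partition from left to right. A partial partition matters for what follows only through
its open arcs, and under an insertion into the current box the total weight depends only on the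
number `h` of open arcs from earlier boxes and the number `k` of those from the current box. If the
elements after the box contribute `L (C_l Q)` when `l` arcs are open, then inserting a box of size
`n` after `h` open arcs gives `L (C_n C_h Q)`: on the sequence `C_{h+k}`, the operator `I` of one
allowed insertion, the operator `J` of the forbidden attachments to the box itself and the scalar
`c` add up to multiplication by `x`, and the commutation rule `I J = b I + a + q J I` turns the
powers of `I` into solutions of the recurrence of `C_n`. Applying this box by box, from the last
one, gives part (i).

For part (ii), the affine substitution of `2 cos θ` by the points of `[A₋, A₊]` carries the
`q`-Charlier polynomials to the continuous big `q`-Hermite polynomials with parameter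
`β = -b / √(a (1 - q))`. These are orthogonal for any functional whose value at the `j`-th
`q`-Hermite polynomial is `β ^ j`. For `β = 0` the values are Fourier coefficients of a theta
product, which the finite Jacobi triple product computes. For `|β| < 1` the weight is the weight for
`β = 0` times the generating function `∑ H_n β ^ n / (q; q)_n` of the `q`-Hermite polynomials, and
the boundary case `|β| = 1` follows by dominated convergence.
-/

namespace QCharlier

/-! ### Three-term recurrences and orthogonality functionals -/

section ThreeTermRecurrence

open Polynomial

variable {R : Type*} [CommRing R]

/-- The sequence of monic polynomials `P` satisfies
`x P_n = P_{n+1} + β_n P_n + γ_n P_{n-1}` with `P_0 = 1`. Truncated subtraction reads `P_{-1}` as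
`P_0`, so the customary `P_{-1} = 0` is the case `γ_0 = 0`. -/
structure ThreeTermRecurrence (P : ℕ → R[X]) (β γ : ℕ → R) : Prop where
  zero : P 0 = 1
  X_mul (n : ℕ) : X * P n = P (n + 1) + C (β n) * P n + C (γ n) * P (n - 1)

/-- The Jacobi operator of a three-term recurrence: multiplication by `x` in the coordinates with
respect to the polynomials `P_n`. -/
noncomputable def jacobiOperator (β γ : ℕ → R) : Module.End R (ℕ →₀ R) :=
  Finsupp.linearCombination R fun n =>
    Finsupp.single (n + 1) 1 + β n • Finsupp.single n 1 + γ n • Finsupp.single (n - 1) 1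

lemma jacobiOperator_single (β γ : ℕ → R) (n : ℕ) :
    jacobiOperator β γ (Finsupp.single n 1) =
      Finsupp.single (n + 1) 1 + β n • Finsupp.single n 1 + γ n • Finsupp.single (n - 1) 1 := by
  simp [jacobiOperator]

namespace ThreeTermRecurrence

variable {P : ℕ → R[X]} {β γ : ℕ → R} (hP : ThreeTermRecurrence P β γ)
include hP

lemma linearCombination_jacobiOperator (v : ℕ →₀ R) :
    Finsupp.linearCombination R P (jacobiOperator β γ v) =
      X * Finsupp.linearCombination R P v := by
  suffices h : Finsupp.linearCombination R P ∘ₗ jacobiOperator β γ =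
      LinearMap.mulLeft R X ∘ₗ Finsupp.linearCombination R P from LinearMap.congr_fun h v
  refine Finsupp.lhom_ext' fun n => LinearMap.ext_ring ?_
  simp [jacobiOperator_single, hP.X_mul, smul_eq_C_mul]

lemma linearCombination_aeval_jacobiOperator (p : R[X]) :
    Finsupp.linearCombination R P (aeval (jacobiOperator β γ) p (Finsupp.single 0 1)) = p := by
  induction p using Polynomial.induction_on with
  | C r => simp [hP.zero, smul_eq_C_mul]
  | add p r hp hr => simp [hp, hr]
  | monomial n r ih =>
    have hX : C r * X ^ (n + 1) = X * (C r * X ^ n) := by ring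
    rw [hX, map_mul, aeval_X, Module.End.mul_apply, hP.linearCombination_jacobiOperator, ih]

lemma aeval_jacobiOperator (n : ℕ) :
    aeval (jacobiOperator β γ) (P n) (Finsupp.single 0 1) = Finsupp.single n 1 := by
  induction n using Nat.strong_induction_on with
  | _ n ih =>
    cases n with
    | zero => simp [hP.zero]
    | succ n =>
      have hJ := congrArg (aeval (jacobiOperator β γ) · (Finsupp.single 0 1)) (hP.X_mul n)
      simp only [map_add, map_mul, aeval_X, aeval_C, Module.End.mul_apply, LinearMap.add_apply,
        Module.algebraMap_end_apply, ih n (by omega), ih (n - 1) (by omega),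
        jacobiOperator_single, add_left_inj] at hJ
      exact hJ.symm

/-- The polynomials `P_n` form a basis: by the recurrence, `p ↦ p(J) e_0`, with `J` the Jacobi
operator, is inverse to `e_n ↦ P_n`. -/
noncomputable def basis : Module.Basis ℕ R R[X] :=
  .ofRepr <| .ofLinearMap
    (LinearMap.applyₗ (Finsupp.single 0 1) ∘ₗ (aeval (jacobiOperator β γ)).toLinearMap)
    (Finsupp.linearCombination R P)
    (Finsupp.lhom_ext' fun n => LinearMap.ext_ring <| by simp [hP.aeval_jacobiOperator])
    (LinearMap.ext fun p => by simpa using hP.linearCombination_aeval_jacobiOperator p)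

lemma basis_apply (n : ℕ) : hP.basis n = P n := by
  simp [basis, Module.Basis.coe_ofRepr]

lemma existsUnique_functional :
    ∃! L : R[X] →ₗ[R] R, ∀ n, L (P n) = if n = 0 then 1 else 0 := by
  refine ⟨hP.basis.coord 0, fun n => ?_, fun L hL => hP.basis.ext fun n => ?_⟩
  · rw [← hP.basis_apply, Module.Basis.coord_apply, Module.Basis.repr_self,
      Finsupp.single_apply]
  · rw [Module.Basis.coord_apply, Module.Basis.repr_self, Finsupp.single_apply, hP.basis_apply,
      hL]

lemma mul_succ_eq {Q : ℕ → R[X]} {β' γ' : ℕ → R} (hQ : ThreeTermRecurrence Q β' γ') (i j : ℕ) :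
    P i * Q (j + 1) = P (i + 1) * Q j + β i • (P i * Q j) + γ i • (P (i - 1) * Q j) -
      β' j • (P i * Q j) - γ' j • (P i * Q (j - 1)) := by
  simp only [smul_eq_C_mul]
  linear_combination Q j * hP.X_mul i - P i * hQ.X_mul j

variable {L : R[X] →ₗ[R] R} (hL : ∀ n, L (P n) = if n = 0 then 1 else 0)
include hL

lemma apply_mul_eq_zero_of_lt {i j : ℕ} (hij : j < i) : L (P i * P j) = 0 := by
  induction j using Nat.strong_induction_on generalizing i with
  | _ j ih =>
    cases j with
    | zero => rw [hP.zero, mul_one, hL, if_neg hij.ne']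
    | succ j =>
      rw [hP.mul_succ_eq hP]
      simp only [map_add, map_sub, map_smul]
      rw [ih j (by omega) (i := i + 1) (by omega), ih j (by omega) (i := i) (by omega),
        ih j (by omega) (i := i - 1) (by omega), ih (j - 1) (by omega) (i := i) (by omega)]
      simp only [smul_zero, add_zero, sub_zero]

lemma apply_mul_eq_zero {i j : ℕ} (hij : i ≠ j) : L (P i * P j) = 0 := by
  rcases hij.lt_or_gt with h | h
  · rw [mul_comm]
    exact hP.apply_mul_eq_zero_of_lt hL h
  · exact hP.apply_mul_eq_zero_of_lt hL h

lemma apply_mul_self (n : ℕ) : L (P n * P n) = ∏ i ∈ Finset.range n, γ (i + 1) := by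
  induction n with
  | zero => simpa [hP.zero] using hL 0
  | succ n ih =>
    rw [hP.mul_succ_eq hP]
    simp only [map_add, map_sub, map_smul]
    rw [hP.apply_mul_eq_zero hL (i := n + 1 + 1) (by omega),
      hP.apply_mul_eq_zero hL (i := n + 1) (j := n) (by omega),
      hP.apply_mul_eq_zero hL (i := n + 1) (j := n - 1) (by omega), Nat.add_sub_cancel, ih,
      Finset.prod_range_succ_comm]
    simp only [smul_eq_mul, mul_zero, zero_add, add_zero, sub_zero]

end ThreeTermRecurrence

end ThreeTermRecurrence

section Charlier

open Polynomial

variable {R : Type*} [CommRing R] (a b c q : R)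

@[simp] lemma qInt_zero : qInt q 0 = 0 := by simp [qInt]

lemma qInt_succ (n : ℕ) : qInt q (n + 1) = qInt q n + q ^ n := by
  simp [qInt, Finset.sum_range_succ]

lemma qInt_succ' (n : ℕ) : qInt q (n + 1) = 1 + q * qInt q n := by
  simp [qInt, Finset.sum_range_succ', Finset.mul_sum, pow_succ', add_comm]

lemma qInt_add (h k : ℕ) : qInt q (h + k) = qInt q k + q ^ k * qInt q h := by
  rw [add_comm h k, qInt, Finset.sum_range_add]
  simp only [pow_add, ← Finset.mul_sum, qInt]

lemma one_sub_mul_qInt (n : ℕ) : (1 - q) * qInt q n = 1 - q ^ n := mul_neg_geom_sum q n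

lemma threeTermRecurrence_charlier :
    ThreeTermRecurrence (charlier a b c q) (fun n => c + b * qInt q n) fun n => a * qInt q n where
  zero := rfl
  X_mul n := by
    cases n with
    | zero => simp [charlier]
    | succ n =>
      rw [charlier]
      simp only [Nat.add_sub_cancel, C_add]
      ring

lemma X_mul_charlier (n : ℕ) :
    X * charlier a b c q n = charlier a b c q (n + 1) + C (c + b * qInt q n) * charlier a b c q n +
      C (a * qInt q n) * charlier a b c q (n - 1) :=
  (threeTermRecurrence_charlier a b c q).X_mul n

variable {a b c q}

lemma isOrthogonalityFunctional_iff {L : R[X] →ₗ[R] R} :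
    IsOrthogonalityFunctional a b c q L ↔
      ∀ n, L (charlier a b c q n) = if n = 0 then 1 else 0 := by
  constructor
  · rintro ⟨h_one, h_orth⟩ n
    split_ifs with hn
    · rw [hn, charlier, h_one]
    · simpa [charlier] using h_orth n 0 hn
  · intro h
    refine ⟨by simpa [charlier] using h 0, fun i j hij => ?_⟩
    exact (threeTermRecurrence_charlier a b c q).apply_mul_eq_zero h hij

variable (a b c q) in
lemma existsUnique_isOrthogonalityFunctional :
    ∃! L : R[X] →ₗ[R] R, IsOrthogonalityFunctional a b c q L := by
  simpa only [isOrthogonalityFunctional_iff] using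
    (threeTermRecurrence_charlier a b c q).existsUnique_functional

end Charlier

/-! ### Linearization of products -/

section Linearization

open Polynomial

variable {R : Type*} [CommRing R] (a b c q : R)
variable {M M' : Type*} [AddCommGroup M] [Module R M] [AddCommGroup M'] [Module R M']

/-- The generating operator of one insertion into a box, acting on functions of the number `h` of
open arcs from earlier boxes and the number `k` of open arcs from the current box: the new element
opens a block, or else continues (weight `b`) or closes (weight `a`) one of the `h` old arcs, which
produces crossings with the `k` new arcs and with the old arcs that started later. -/
def insertStep : Module.End R (ℕ → ℕ → M) where
  toFun f h k := f h (k + 1) + (b * q ^ k * qInt q h) • f (h - 1) (k + 1) +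
    (a * q ^ k * qInt q h) • f (h - 1) k
  map_add' f g := by ext h k; simp only [Pi.add_apply, smul_add]; abel
  map_smul' r f := by
    ext h k
    simp only [Pi.smul_apply, smul_add, smul_comm r, RingHom.id_apply]

/-- The generating operator of the insertions that a box forbids: the new element continues or
closes one of the `k` arcs that start in its own box. -/
def attachStep : Module.End R (ℕ → ℕ → M) where
  toFun f h k := (b * qInt q k) • f h k + (a * qInt q k) • f h (k - 1)
  map_add' f g := by ext h k; simp only [Pi.add_apply, smul_add]; abel
  map_smul' r f := by
    ext h k
    simp only [Pi.smul_apply, smul_add, smul_comm r, RingHom.id_apply]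

variable {a b q} in
lemma insertStep_apply (f : ℕ → ℕ → M) (h k : ℕ) :
    insertStep a b q f h k = f h (k + 1) + (b * q ^ k * qInt q h) • f (h - 1) (k + 1) +
      (a * q ^ k * qInt q h) • f (h - 1) k := rfl

variable {a b q} in
lemma attachStep_apply (f : ℕ → ℕ → M) (h k : ℕ) :
    attachStep a b q f h k = (b * qInt q k) • f h k + (a * qInt q k) • f h (k - 1) := rfl

lemma insertStep_mul_attachStep :
    (insertStep a b q * attachStep a b q : Module.End R (ℕ → ℕ → M)) =
      b • insertStep a b q + a • 1 + q • (attachStep a b q * insertStep a b q) := by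
  ext f h k
  simp only [Module.End.mul_apply, LinearMap.add_apply, LinearMap.smul_apply,
    Module.End.one_apply, Pi.add_apply, Pi.smul_apply, insertStep_apply, attachStep_apply]
  cases k with
  | zero =>
    simp only [zero_add, qInt_succ', qInt_zero]
    module
  | succ k =>
    simp only [Nat.add_sub_cancel, qInt_succ' q (k + 1), pow_succ]
    module

lemma insertStep_pow_comp (φ : M →ₗ[R] M') (f : ℕ → ℕ → M) (n h k : ℕ) :
    (insertStep a b q ^ n) (fun h k => φ (f h k)) h k = φ ((insertStep a b q ^ n) f h k) := by
  induction n generalizing h k with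
  | zero => rfl
  | succ n ih =>
    simp only [pow_succ', Module.End.mul_apply, insertStep_apply, ih, map_add, map_smul]

lemma X_mul_charlier_add (h k : ℕ) :
    X * charlier a b c q (h + k) =
      insertStep a b q (fun h k => charlier a b c q (h + k)) h k + c • charlier a b c q (h + k) +
        attachStep a b q (fun h k => charlier a b c q (h + k)) h k := by
  have continue_eq : qInt q h • charlier a b c q (h - 1 + (k + 1)) =
      qInt q h • charlier a b c q (h + k) := by
    cases h with
    | zero => simp
    | succ h => congr 2; omega
  have close_eq : qInt q h • charlier a b c q (h - 1 + k) =
      qInt q h • charlier a b c q (h + k - 1) := by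
    cases h with
    | zero => simp
    | succ h => congr 2; omega
  have attach_eq : qInt q k • charlier a b c q (h + (k - 1)) =
      qInt q k • charlier a b c q (h + k - 1) := by
    cases k with
    | zero => simp
    | succ k => rfl
  rw [X_mul_charlier, qInt_add, insertStep_apply, attachStep_apply, mul_smul _ (qInt q h),
    continue_eq, mul_smul _ (qInt q h), close_eq, mul_smul a (qInt q k), attach_eq]
  simp only [← smul_eq_C_mul, ← add_assoc h k 1]
  module

lemma insertStep_mul_insertStep_pow_expansion (n : ℕ) :
    (insertStep a b q * (insertStep a b q ^ (n + 1) + (c + b * qInt q n) • insertStep a b q ^ n +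
        (a * qInt q n) • insertStep a b q ^ (n - 1) +
        q ^ n • (attachStep a b q * insertStep a b q ^ n)) : Module.End R (ℕ → ℕ → M)) =
      insertStep a b q ^ (n + 2) + (c + b * qInt q (n + 1)) • insertStep a b q ^ (n + 1) +
        (a * qInt q (n + 1)) • insertStep a b q ^ n +
        q ^ (n + 1) • (attachStep a b q * insertStep a b q ^ (n + 1)) := by
  have insert_pred : qInt q n • (insertStep a b q * insertStep a b q ^ (n - 1)) =
      qInt q n • (insertStep a b q ^ n : Module.End R (ℕ → ℕ → M)) := by
    cases n with
    | zero => simp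
    | succ n => rw [Nat.add_sub_cancel, pow_succ']
  have insert_attach : insertStep a b q * (attachStep a b q * insertStep a b q ^ n) =
      b • insertStep a b q ^ (n + 1) + a • insertStep a b q ^ n +
        q • (attachStep a b q * (insertStep a b q ^ (n + 1) : Module.End R (ℕ → ℕ → M))) := by
    rw [← mul_assoc, insertStep_mul_attachStep, pow_succ']
    simp only [add_mul, smul_mul_assoc, one_mul, mul_assoc]
  simp only [mul_add, mul_smul_comm, insert_attach, mul_smul a, insert_pred]
  simp only [← pow_succ', qInt_succ]
  module

lemma X_mul_insertStep_pow (n h k : ℕ) :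
    X * (insertStep a b q ^ n) (fun h k => charlier a b c q (h + k)) h k =
      (insertStep a b q ^ (n + 1) + (c + b * qInt q n) • insertStep a b q ^ n +
        (a * qInt q n) • insertStep a b q ^ (n - 1) +
        q ^ n • (attachStep a b q * insertStep a b q ^ n) : Module.End R (ℕ → ℕ → R[X]))
          (fun h k => charlier a b c q (h + k)) h k := by
  induction n generalizing h k with
  | zero => simpa using X_mul_charlier_add a b c q h k
  | succ n ih =>
    have X_insert (f : ℕ → ℕ → R[X]) : X * insertStep a b q f h k =
        insertStep a b q (fun h k => X * f h k) h k := by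
      simp only [insertStep_apply, mul_add, mul_smul_comm]
    rw [pow_succ', Module.End.mul_apply, X_insert, funext₂ ih, ← pow_succ', Nat.add_sub_cancel,
      ← insertStep_mul_insertStep_pow_expansion]
    rfl

/-- The box operator linearizes products: inserting a box of size `n` after `h` open arcs gives the
`C_l`-expansion of `C_n C_h`. -/
lemma insertStep_pow_charlier (n h : ℕ) :
    (insertStep a b q ^ n) (fun h k => charlier a b c q (h + k)) h 0 =
      charlier a b c q n * charlier a b c q h := by
  induction n using Nat.strong_induction_on with
  | _ n ih =>
    cases n with
    | zero => simp [charlier]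
    | succ n =>
      have h_insert := X_mul_insertStep_pow a b c q n h 0
      simp only [LinearMap.add_apply, LinearMap.smul_apply, Pi.add_apply, Pi.smul_apply,
        Module.End.mul_apply, attachStep_apply, ih n (by omega), ih (n - 1) (by omega), qInt_zero,
        mul_zero, zero_smul, add_zero, smul_zero, smul_eq_C_mul] at h_insert
      linear_combination charlier a b c q h * X_mul_charlier a b c q n - h_insert

end Linearization

/-! ### Histories and their transfer weights -/

section Automaton

variable {R S A : Type*} [CommRing R] [Fintype A] (step : ℕ → S → A → S) (w : ℕ → S → A → R)
  (f : S → R)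

/-- The total weight of the words of length `n` read from the state `s` at time `t` by an automaton
with transition function `step`: reading `x` in the state `s` at time `t` has weight `w t s x`, and
ending in the state `s` has weight `f s`. -/
def transfer : ℕ → ℕ → S → R
  | 0, _, s => f s
  | n + 1, t, s => ∑ x, w t s x * transfer n (t + 1) (step t s x)

lemma sum_prod_eq_transfer (n t : ℕ) (s : S) (state : (Fin n → A) → ℕ → S)
    (state_zero : ∀ σ, state σ 0 = s)
    (state_succ : ∀ σ (j : Fin n), state σ (j + 1) = step (t + j) (state σ j) (σ j)) :
    ∑ σ, (∏ j : Fin n, w (t + j) (state σ j) (σ j)) * f (state σ n) = transfer step w f n t s := by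
  induction n generalizing t s with
  | zero => simp [transfer, state_zero]
  | succ n ih =>
    rw [← (Fin.consEquiv fun _ => A).sum_comp, Fintype.sum_prod_type, transfer]
    refine Finset.sum_congr rfl fun x _ => ?_
    rw [← ih (t + 1) _ fun σ j => state (Fin.cons x σ) (j + 1), Finset.mul_sum]
    · refine Finset.sum_congr rfl fun σ _ => ?_
      simp [Fin.consEquiv, Fin.prod_univ_succ, state_zero, mul_assoc, add_assoc, add_comm 1]
    · intro σ
      simpa [state_zero] using state_succ (Fin.cons x σ) 0
    · intro σ j
      simpa [add_assoc, add_comm 1] using state_succ (Fin.cons x σ) j.succ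

end Automaton

variable {N : ℕ}

/-- What a set partition does at one element: the predecessor of the element in its block, if there
is one, and whether the element has a successor. -/
abbrev Step (N : ℕ) : Type := Option (Fin N) × Bool

/-- The elements waiting for a successor after the step `x` at the element `t`, if those of `O` were
waiting before it. -/
def nextOpen (t : ℕ) (O : Finset (Fin N)) (x : Step N) : Finset (Fin N) :=
  {i | (i ∈ O ∧ x.1 ≠ some i) ∨ ((i : ℕ) = t ∧ x.2 = true)}

/-- The step `x` at the element `t` creates no singleton, and it chooses its predecessor among the
open elements that lie before `β t`, the start of the box of `t`. -/
def Admissible (β : ℕ → ℕ) (t : ℕ) (O : Finset (Fin N)) (x : Step N) : Prop :=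
  (x.1 = none → x.2 = true) ∧ ∀ i, x.1 = some i → i ∈ O ∧ (i : ℕ) < β t

instance (β : ℕ → ℕ) (t : ℕ) (O : Finset (Fin N)) (x : Step N) : Decidable (Admissible β t O x) :=
  inferInstanceAs (Decidable (_ ∧ _))

/-- The elements of `O` that lie before `s`. -/
def oldPart (s : ℕ) (O : Finset (Fin N)) : Finset (Fin N) := {i ∈ O | (i : ℕ) < s}

/-- The elements of `O` that do not lie before `s`. -/
def newPart (s : ℕ) (O : Finset (Fin N)) : Finset (Fin N) := {i ∈ O | s ≤ (i : ℕ)}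

lemma card_oldPart_add_card_newPart (s : ℕ) (O : Finset (Fin N)) :
    (oldPart s O).card + (newPart s O).card = O.card := by
  simpa only [oldPart, newPart, not_lt] using
    Finset.card_filter_add_card_filter_not (s := O) fun i => (i : ℕ) < s

lemma card_filter_gt_of_mem_oldPart {s : ℕ} {O : Finset (Fin N)} {i : Fin N}
    (hi : i ∈ oldPart s O) :
    {k ∈ O | i < k}.card = (newPart s O).card + {k ∈ oldPart s O | i < k}.card := by
  rw [oldPart, Finset.mem_filter] at hi
  rw [← Finset.card_filter_add_card_filter_not (s := {k ∈ O | i < k}) fun k => s ≤ (k : ℕ),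
    oldPart, newPart, Finset.filter_filter, Finset.filter_filter, Finset.filter_filter]
  congr 2 <;> ext k <;> simp only [Finset.mem_filter, Fin.lt_def] <;> grind

lemma lt_of_mem_nextOpen {t : ℕ} {O : Finset (Fin N)} (hO : ∀ i ∈ O, (i : ℕ) < t) {x : Step N}
    {i : Fin N} (hi : i ∈ nextOpen t O x) : (i : ℕ) < t + 1 := by
  simp only [nextOpen, Finset.mem_filter_univ] at hi
  grind

lemma oldPart_nextOpen_none {s t : ℕ} (hst : s ≤ t) (O : Finset (Fin N)) (f : Bool) :
    oldPart s (nextOpen t O (none, f)) = oldPart s O := by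
  ext i
  simp only [oldPart, nextOpen, Finset.mem_filter, Finset.mem_univ]
  grind

lemma oldPart_nextOpen_some {s t : ℕ} (hst : s ≤ t) (O : Finset (Fin N)) (i : Fin N) (f : Bool) :
    oldPart s (nextOpen t O (some i, f)) = (oldPart s O).erase i := by
  ext j
  simp only [oldPart, nextOpen, Finset.mem_filter, Finset.mem_univ, Finset.mem_erase]
  grind

lemma card_newPart_nextOpen {s t : ℕ} {O : Finset (Fin N)} {x : Step N} (hst : s ≤ t) (htN : t < N)
    (hO : ∀ i ∈ O, (i : ℕ) < t) (hx : ∀ i, x.1 = some i → (i : ℕ) < s) :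
    (newPart s (nextOpen t O x)).card = (newPart s O).card + if x.2 then 1 else 0 := by
  have not_mem : (⟨t, htN⟩ : Fin N) ∉ newPart s O := fun h =>
    (hO _ (Finset.mem_filter.1 h).1).false
  have newPart_eq : newPart s (nextOpen t O x) =
      if x.2 then insert ⟨t, htN⟩ (newPart s O) else newPart s O := by
    ext i
    have hxi := hx i
    split_ifs with hf <;> simp [newPart, nextOpen, hf, Fin.ext_iff] <;> grind
  rw [newPart_eq]
  split_ifs
  · exact Finset.card_insert_of_notMem not_mem
  · rfl

variable {R : Type*} [CommRing R] (a b q : R)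

lemma sum_pow_card_gt {α : Type*} [LinearOrder α] (S : Finset α) :
    ∑ i ∈ S, q ^ {k ∈ S | i < k}.card = qInt q S.card := by
  induction S using Finset.induction_on_min with
  | empty => simp
  | insert x S hx ih =>
    have hxS : x ∉ S := fun h => (hx x h).false
    rw [Finset.sum_insert hxS, Finset.card_insert_of_notMem hxS, qInt_succ, ← ih, add_comm]
    congr 1
    · refine Finset.sum_congr rfl fun i hi => ?_
      rw [Finset.filter_insert, if_neg (hx i hi).not_gt]
    · rw [Finset.filter_insert, if_neg (lt_irrefl x), Finset.filter_true_of_mem hx]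

/-- The weight of an admissible step: `a` if the block ends here, `b` if it continues, and a factor
`q` for each open element after the predecessor, because its arc will cross the one that ends
here. -/
def chosenWeight (O : Finset (Fin N)) (x : Step N) : R :=
  x.1.elim 1 fun i => (if x.2 then b else a) * q ^ {k ∈ O | i < k}.card

/-- The weight of a step, zero if the step is not admissible. -/
def stepWeight (β : ℕ → ℕ) (t : ℕ) (O : Finset (Fin N)) (x : Step N) : R :=
  if Admissible β t O x then chosenWeight a b q O x else 0

/-- The total weight of the sequences of `n` steps which start at the element `t` with the open
elements `O` and leave no element open. -/
def closingWeight (β : ℕ → ℕ) : ℕ → ℕ → Finset (Fin N) → R :=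
  transfer nextOpen (stepWeight a b q β) fun O => if O = ∅ then 1 else 0

variable {β : ℕ → ℕ}

lemma closingWeight_zero (t : ℕ) (O : Finset (Fin N)) :
    closingWeight a b q β 0 t O = if O = ∅ then 1 else 0 := rfl

lemma closingWeight_succ (n t : ℕ) (O : Finset (Fin N)) :
    closingWeight a b q β (n + 1) t O =
      closingWeight a b q β n (t + 1) (nextOpen t O (none, true)) +
        ∑ i ∈ oldPart (β t) O, q ^ {k ∈ O | i < k}.card *
          (b * closingWeight a b q β n (t + 1) (nextOpen t O (some i, true)) +
            a * closingWeight a b q β n (t + 1) (nextOpen t O (some i, false))) := by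
  have mem_oldPart (i : Fin N) : i ∈ oldPart (β t) O ↔ i ∈ O ∧ (i : ℕ) < β t := by simp [oldPart]
  rw [closingWeight, transfer, Fintype.sum_prod_type, Fintype.sum_option]
  congr 1
  · simp [stepWeight, Admissible, chosenWeight]
  · rw [← Finset.sum_subset (Finset.subset_univ (oldPart (β t) O))]
    · refine Finset.sum_congr rfl fun i hi => ?_
      simp only [stepWeight, Admissible, reduceCtorEq, IsEmpty.forall_iff, Option.some.injEq,
        forall_eq', (mem_oldPart i).1 hi, and_self, if_true, chosenWeight, Option.elim_some,
        Fintype.sum_bool, Bool.false_eq_true, if_false]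
      ring
    · intro i _ hi
      simp [stepWeight, Admissible, (mem_oldPart i).not.1 hi]

section Box

variable {s l n : ℕ} (hlN : s + l ≤ N) (hβ : ∀ t, s ≤ t → t < s + l → β t = s)
include hlN hβ

lemma closingWeight_succ_eq_insertStep {t : ℕ} (hst : s ≤ t) (htl : t < s + l)
    {g : ℕ → ℕ → R} (hg : ∀ O : Finset (Fin N), (∀ i ∈ O, (i : ℕ) < t + 1) →
      closingWeight a b q β n (t + 1) O = g (oldPart s O).card (newPart s O).card)
    {O : Finset (Fin N)} (hO : ∀ i ∈ O, (i : ℕ) < t) :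
    closingWeight a b q β (n + 1) t O =
      insertStep a b q g (oldPart s O).card (newPart s O).card := by
  have weight_open : closingWeight a b q β n (t + 1) (nextOpen t O (none, true)) =
      g (oldPart s O).card ((newPart s O).card + 1) := by
    rw [hg _ fun i hi => lt_of_mem_nextOpen hO hi, oldPart_nextOpen_none hst,
      card_newPart_nextOpen hst (by omega) hO (by simp)]
    rfl
  have weight_choose (i : Fin N) (hi : i ∈ oldPart s O) (f : Bool) :
      closingWeight a b q β n (t + 1) (nextOpen t O (some i, f)) =
        g ((oldPart s O).card - 1) ((newPart s O).card + if f then 1 else 0) := by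
    have his : (i : ℕ) < s := (Finset.mem_filter.1 hi).2
    rw [hg _ fun i hi => lt_of_mem_nextOpen hO hi, oldPart_nextOpen_some hst,
      Finset.card_erase_of_mem hi, card_newPart_nextOpen hst (by omega) hO (by simpa using his)]
  have sum_choose : ∑ i ∈ oldPart s O, q ^ {k ∈ O | i < k}.card *
      (b * closingWeight a b q β n (t + 1) (nextOpen t O (some i, true)) +
        a * closingWeight a b q β n (t + 1) (nextOpen t O (some i, false))) =
      qInt q (oldPart s O).card * (q ^ (newPart s O).card *
        (b * g ((oldPart s O).card - 1) ((newPart s O).card + 1) +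
          a * g ((oldPart s O).card - 1) (newPart s O).card)) := by
    rw [← sum_pow_card_gt, Finset.sum_mul]
    refine Finset.sum_congr rfl fun i hi => ?_
    rw [weight_choose i hi, weight_choose i hi, card_filter_gt_of_mem_oldPart hi, pow_add]
    simp only [if_true, Bool.false_eq_true, if_false, add_zero]
    ring
  rw [closingWeight_succ, hβ t hst htl, weight_open, sum_choose, insertStep_apply]
  simp only [smul_eq_mul]
  ring

lemma closingWeight_box {g : ℕ → R} (hg : ∀ O : Finset (Fin N), (∀ i ∈ O, (i : ℕ) < s + l) →
      closingWeight a b q β n (s + l) O = g O.card)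
    {r t : ℕ} (htr : t + r = s + l) (hst : s ≤ t) {O : Finset (Fin N)}
    (hO : ∀ i ∈ O, (i : ℕ) < t) :
    closingWeight a b q β (n + r) t O =
      (insertStep a b q ^ r) (fun h k => g (h + k)) (oldPart s O).card (newPart s O).card := by
  induction r generalizing t O with
  | zero =>
    obtain rfl : t = s + l := htr
    rw [pow_zero, Module.End.one_apply, card_oldPart_add_card_newPart]
    exact hg O hO
  | succ r ih =>
    rw [pow_succ', Module.End.mul_apply]
    exact closingWeight_succ_eq_insertStep a b q hlN hβ hst (by omega)
      (fun O hO => ih (by omega) (by omega) hO) hO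

end Box

section Boxes

open Polynomial

variable {m : ℕ} (n : Fin m → ℕ)

/-- The number of elements in the first `k` boxes, i.e. the first element of the box `k`. -/
def boxStart (k : ℕ) : ℕ := ∑ i ∈ ({i | (i : ℕ) < k} : Finset (Fin m)), n i

/-- The first element of the box that contains `t`. -/
def currentStart (t : ℕ) : ℕ := {k ∈ Finset.range (m + 1) | boxStart n k ≤ t}.sup (boxStart n)

@[simp] lemma boxStart_zero : boxStart n 0 = 0 := by simp [boxStart]

lemma boxStart_length : boxStart n m = ∑ i, n i := by simp [boxStart]

lemma boxStart_succ (j : Fin m) : boxStart n (j + 1) = boxStart n j + n j := by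
  have filter_eq : ({i | (i : ℕ) < j + 1} : Finset (Fin m)) =
      insert j ({i | (i : ℕ) < j} : Finset (Fin m)) := by
    ext i
    simp only [Finset.mem_filter_univ, Finset.mem_insert, Fin.ext_iff]
    omega
  rw [boxStart, filter_eq, Finset.sum_insert (by simp), add_comm, boxStart]

lemma boxStart_mono : Monotone (boxStart n) := fun k l hkl =>
  Finset.sum_le_sum_of_subset fun i hi => by
    simp only [Finset.mem_filter_univ] at hi ⊢
    omega

lemma currentStart_eq {k t : ℕ} (hk : k < m) (hkt : boxStart n k ≤ t)
    (htk : t < boxStart n (k + 1)) : currentStart n t = boxStart n k := by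
  refine le_antisymm (Finset.sup_le fun l hl => boxStart_mono n ?_) <|
    Finset.le_sup (f := boxStart n) (by simp only [Finset.mem_filter, Finset.mem_range]; omega)
  by_contra! hkl
  exact (htk.trans_le (boxStart_mono n hkl)).not_ge (Finset.mem_filter.1 hl).2

lemma exists_boxStart_le_lt {t k : ℕ} (ht : t < boxStart n k) :
    ∃ j < k, boxStart n j ≤ t ∧ t < boxStart n (j + 1) := by
  induction k with
  | zero => simp at ht
  | succ k ih =>
    by_cases htk : t < boxStart n k
    · obtain ⟨j, hjk, hj⟩ := ih htk
      exact ⟨j, by omega, hj⟩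
    · exact ⟨k, by omega, by omega, ht⟩

lemma mem_box_iff {j : Fin m} {x : Fin (∑ i, n i)} :
    x ∈ box n j ↔ boxStart n j ≤ x ∧ (x : ℕ) < boxStart n (j + 1) := by
  have Iio_eq : Finset.Iio j = ({i | (i : ℕ) < j} : Finset (Fin m)) := by ext i; simp
  have Iic_eq : Finset.Iic j = ({i | (i : ℕ) < j + 1} : Finset (Fin m)) := by ext i; simp
  rw [box, Finset.mem_filter_univ, Iio_eq, Iic_eq, boxStart, boxStart]

lemma exists_mem_box_iff {x y : Fin (∑ i, n i)} (hxy : x < y) :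
    (∃ j, x ∈ box n j ∧ y ∈ box n j) ↔ currentStart n y ≤ x := by
  simp only [mem_box_iff]
  constructor
  · rintro ⟨j, hx, hy⟩
    rw [currentStart_eq n j.2 hy.1 hy.2]
    exact hx.1
  · intro hx
    obtain ⟨j, hj, hy⟩ := exists_boxStart_le_lt n (y.2.trans_eq (boxStart_length n).symm)
    rw [currentStart_eq n hj hy.1 hy.2] at hx
    exact ⟨⟨j, hj⟩, ⟨hx, lt_trans hxy hy.2⟩, hy⟩

variable {R : Type*} [CommRing R] {a b c q : R}

lemma closingWeight_box_eq_apply_charlier (L : R[X] →ₗ[R] R) (Q : R[X]) {N s l r : ℕ}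
    {β : ℕ → ℕ} (hlN : s + l ≤ N) (hβ : ∀ t, s ≤ t → t < s + l → β t = s)
    (hQ : ∀ O : Finset (Fin N), (∀ i ∈ O, (i : ℕ) < s + l) →
      closingWeight a b q β r (s + l) O = L (charlier a b c q O.card * Q))
    {O : Finset (Fin N)} (hO : ∀ i ∈ O, (i : ℕ) < s) :
    closingWeight a b q β (r + l) s O =
      L (charlier a b c q O.card * (charlier a b c q l * Q)) := by
  have oldPart_eq : oldPart s O = O := Finset.filter_true_of_mem hO
  have newPart_eq : newPart s O = ∅ := Finset.filter_false_of_mem fun i hi => (hO i hi).not_ge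
  have h_comp := insertStep_pow_comp a b q (L ∘ₗ LinearMap.mulRight R Q)
    (fun h k => charlier a b c q (h + k)) l O.card 0
  rw [insertStep_pow_charlier] at h_comp
  rw [closingWeight_box a b q hlN hβ (g := fun h => L (charlier a b c q h * Q)) hQ rfl le_rfl hO,
    oldPart_eq, newPart_eq, Finset.card_empty, ← mul_assoc, mul_comm (charlier a b c q O.card)]
  exact h_comp

lemma closingWeight_boxStart {L : R[X] →ₗ[R] R} (hL : IsOrthogonalityFunctional a b c q L)
    {k : ℕ} (hk : k ≤ m) {O : Finset (Fin (∑ i, n i))} (hO : ∀ i ∈ O, (i : ℕ) < boxStart n k) :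
    closingWeight a b q (currentStart n) ((∑ i, n i) - boxStart n k) (boxStart n k) O =
      L (charlier a b c q O.card *
        ∏ i ∈ ({i | k ≤ (i : ℕ)} : Finset (Fin m)), charlier a b c q (n i)) := by
  induction hk using Nat.decreasingInduction generalizing O with
  | self =>
    have filter_eq : ({i | m ≤ (i : ℕ)} : Finset (Fin m)) = ∅ := by ext i; simp
    simp [boxStart_length, closingWeight_zero, filter_eq, isOrthogonalityFunctional_iff.1 hL]
  | of_succ k hk ih =>
    have hs : boxStart n (k + 1) = boxStart n k + n ⟨k, hk⟩ := boxStart_succ n ⟨k, hk⟩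
    have hsN : boxStart n (k + 1) ≤ ∑ i, n i :=
      (boxStart_mono n hk).trans_eq (boxStart_length n)
    have filter_eq : ({i | k ≤ (i : ℕ)} : Finset (Fin m)) =
        insert ⟨k, hk⟩ ({i | k + 1 ≤ (i : ℕ)} : Finset (Fin m)) := by
      ext i
      simp only [Finset.mem_filter_univ, Finset.mem_insert, Fin.ext_iff]
      omega
    have length_eq : (∑ i, n i) - boxStart n k = (∑ i, n i) - boxStart n (k + 1) + n ⟨k, hk⟩ := by
      omega
    rw [filter_eq, Finset.prod_insert (by simp), length_eq]
    refine closingWeight_box_eq_apply_charlier L _ (hs ▸ hsN)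
      (fun t hkt htk => currentStart_eq n hk hkt (hs ▸ htk)) ?_ hO
    rw [← hs]
    exact fun O hO => ih hO

lemma closingWeight_eq_apply_prod_charlier {L : R[X] →ₗ[R] R}
    (hL : IsOrthogonalityFunctional a b c q L) :
    closingWeight a b q (currentStart n) (∑ i, n i) 0 (∅ : Finset (Fin (∑ i, n i))) =
      L (∏ i, charlier a b c q (n i)) := by
  simpa [charlier] using
    closingWeight_boxStart n hL (Nat.zero_le m) (O := ∅) (by simp)

end Boxes

/-! ### Arcs and histories of set partitions -/

section Arcs

variable {N : ℕ} {π : SetPartition N}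

lemma part_eq_part_iff_mem {B : Finset (Fin N)} (hB : B ∈ π.parts) {i j : Fin N} (hj : j ∈ B) :
    π.part i = π.part j ↔ i ∈ B := by
  rw [π.part_eq_of_mem hB hj, π.part_eq_iff_mem hB]

lemma isArc_iff {i j : Fin N} : IsArc π i j ↔
    i < j ∧ π.part i = π.part j ∧ ∀ p, π.part p = π.part j → ¬ (i < p ∧ p < j) := by
  constructor
  · rintro ⟨hij, B, hB, hi, hj, h⟩
    exact ⟨hij, (part_eq_part_iff_mem hB hj).2 hi, fun p hp =>
      h p ((part_eq_part_iff_mem hB hj).1 hp)⟩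
  · rintro ⟨hij, h_part, h⟩
    have hB : π.part j ∈ π.parts := by simp
    have hj := π.mem_part (Finset.mem_univ j)
    exact ⟨hij, π.part j, hB, (part_eq_part_iff_mem hB hj).1 h_part, hj, fun p hp =>
      h p ((part_eq_part_iff_mem hB hj).2 hp)⟩

namespace IsArc

lemma lt {i j : Fin N} (h : IsArc π i j) : i < j := h.1

lemma part_eq {i j : Fin N} (h : IsArc π i j) : π.part i = π.part j := (isArc_iff.1 h).2.1

lemma left_unique {i i' j : Fin N} (h : IsArc π i j) (h' : IsArc π i' j) : i = i' := by
  by_contra! hne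
  rcases hne.lt_or_gt with hlt | hlt
  · exact (isArc_iff.1 h).2.2 i' h'.part_eq ⟨hlt, h'.lt⟩
  · exact (isArc_iff.1 h').2.2 i h.part_eq ⟨hlt, h.lt⟩

lemma right_unique {i j j' : Fin N} (h : IsArc π i j) (h' : IsArc π i j') : j = j' := by
  have h_part : π.part j = π.part j' := h.part_eq.symm.trans h'.part_eq
  by_contra! hne
  rcases hne.lt_or_gt with hlt | hlt
  · exact (isArc_iff.1 h').2.2 j h_part ⟨h.lt, hlt⟩
  · exact (isArc_iff.1 h).2.2 j' h_part.symm ⟨h'.lt, hlt⟩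

end IsArc

lemma exists_isArc_left {i j : Fin N} (hij : i < j) (h : π.part i = π.part j) :
    ∃ i', i ≤ i' ∧ IsArc π i' j := by
  obtain ⟨i', hi', hmax⟩ := Finset.exists_max_image
    {k | k < j ∧ π.part k = π.part j} id ⟨i, by simp [hij, h]⟩
  simp only [Finset.mem_filter_univ, id] at hi' hmax
  exact ⟨i', hmax i ⟨hij, h⟩, isArc_iff.2 ⟨hi'.1, hi'.2, fun p hp hlt =>
    (hmax p ⟨hlt.2, hp⟩).not_gt hlt.1⟩⟩

lemma exists_isArc_right {i j : Fin N} (hij : i < j) (h : π.part i = π.part j) :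
    ∃ j', IsArc π i j' := by
  obtain ⟨j', hj', hmin⟩ := Finset.exists_min_image
    {k | i < k ∧ π.part i = π.part k} id ⟨j, by simp [hij, h]⟩
  simp only [Finset.mem_filter_univ, id] at hj' hmin
  exact ⟨j', isArc_iff.2 ⟨hj'.1, hj'.2, fun p hp hlt =>
    (hmin p ⟨hlt.1, hj'.2.trans hp.symm⟩).not_gt hlt.2⟩⟩

lemma setPartition_ext {π' : SetPartition N}
    (h : ∀ i j, π.part i = π.part j ↔ π'.part i = π'.part j) : π = π' := by
  have part_eq (i : Fin N) : π.part i = π'.part i := by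
    ext j
    rw [π.mem_part_iff_part_eq_part (Finset.mem_univ _) (Finset.mem_univ _),
      π'.mem_part_iff_part_eq_part (Finset.mem_univ _) (Finset.mem_univ _), h]
  have parts_subset (ρ ρ' : SetPartition N) (h : ∀ i, ρ.part i = ρ'.part i) :
      ρ.parts ⊆ ρ'.parts := by
    intro B hB
    obtain ⟨i, hi⟩ := ρ.nonempty_of_mem_parts hB
    rw [← ρ.part_eq_of_mem hB hi, h i]
    simp
  exact Finpartition.ext <|
    (parts_subset π π' part_eq).antisymm (parts_subset π' π fun i => (part_eq i).symm)

variable (π)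

open Classical in
/-- The predecessor of an element in its block, if there is one. -/
noncomputable def pred (j : Fin N) : Option (Fin N) :=
  if h : ∃ i, IsArc π i j then some h.choose else none

variable {π}

lemma pred_eq_some {i j : Fin N} : pred π j = some i ↔ IsArc π i j := by
  rw [pred]
  split_ifs with h
  · rw [Option.some_inj]
    exact ⟨fun e => e ▸ h.choose_spec, fun h' => h.choose_spec.left_unique h'⟩
  · simpa using fun h' => h ⟨i, h'⟩

lemma pred_eq_none {j : Fin N} : pred π j = none ↔ ∀ i, ¬ IsArc π i j := by
  simp only [← pred_eq_some, Option.eq_none_iff_forall_ne_some]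

end Arcs

section Root

variable {N : ℕ}

/-- The end of the chain of predecessors of an element, `p` being the predecessor function. Only
predecessors that are smaller than the element are followed, which makes this well-founded for
every `p`. -/
def root (p : Fin N → Option (Fin N)) (j : Fin N) : Fin N :=
  match p j with
  | none => j
  | some i => if i < j then root p i else j
termination_by j

variable {p : Fin N → Option (Fin N)}

lemma root_of_none {j : Fin N} (h : p j = none) : root p j = j := by
  rw [root, h]

lemma root_of_some {i j : Fin N} (h : p j = some i) (hij : i < j) : root p j = root p i := by
  rw [root, h]
  exact if_pos hij

lemma part_root_pred {π : SetPartition N} (j : Fin N) :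
    π.part (root (pred π) j) = π.part j ∧ pred π (root (pred π) j) = none := by
  induction j using WellFoundedLT.induction with
  | _ j ih =>
    cases h : pred π j with
    | none =>
      rw [root_of_none h]
      exact ⟨rfl, h⟩
    | some i =>
      have h_arc := pred_eq_some.1 h
      rw [root_of_some h h_arc.lt]
      exact ⟨(ih i h_arc.lt).1.trans h_arc.part_eq, (ih i h_arc.lt).2⟩

lemma root_pred_eq_iff {π : SetPartition N} {i j : Fin N} :
    root (pred π) i = root (pred π) j ↔ π.part i = π.part j := by
  obtain ⟨part_i, pred_i⟩ := part_root_pred (π := π) i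
  obtain ⟨part_j, pred_j⟩ := part_root_pred (π := π) j
  refine ⟨fun h => by rw [← part_i, h, part_j], fun h => ?_⟩
  have part_eq : π.part (root (pred π) i) = π.part (root (pred π) j) := by rw [part_i, part_j, h]
  rw [pred_eq_none] at pred_i pred_j
  by_contra! hne
  rcases hne.lt_or_gt with hlt | hlt
  · obtain ⟨k, -, hk⟩ := exists_isArc_left hlt part_eq
    exact pred_j k hk
  · obtain ⟨k, -, hk⟩ := exists_isArc_left hlt part_eq.symm
    exact pred_i k hk

lemma pred_injective : Function.Injective (pred : SetPartition N → _) := fun π π' h =>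
  setPartition_ext fun i j => by rw [← root_pred_eq_iff, ← root_pred_eq_iff, h]

open Classical in
/-- The set partition with the predecessor function `p`: its blocks are the fibres of `root p`. -/
noncomputable def ofPred (p : Fin N → Option (Fin N)) : SetPartition N :=
  Finpartition.ofSetoid (Setoid.ker (root p))

lemma part_ofPred_eq_iff {i j : Fin N} :
    (ofPred p).part i = (ofPred p).part j ↔ root p i = root p j := by
  classical
  rw [← (ofPred p).mem_part_iff_part_eq_part (Finset.mem_univ _) (Finset.mem_univ _)]
  exact Finpartition.mem_part_ofSetoid_iff_rel.trans (Setoid.ker_def.trans eq_comm)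

section PredecessorFunction

variable (hlt : ∀ i j, p j = some i → i < j)
include hlt

lemma root_le (j : Fin N) : root p j ≤ j := by
  induction j using WellFoundedLT.induction with
  | _ j ih =>
    cases h : p j with
    | none => rw [root_of_none h]
    | some i =>
      rw [root_of_some h (hlt i j h)]
      exact (ih i (hlt i j h)).trans (hlt i j h).le

variable (hinj : ∀ i j j', p j = some i → p j' = some i → j = j')
include hinj

lemma exists_succ_of_root_eq {i j : Fin N} (hij : i < j) (h : root p i = root p j) :
    ∃ k, i < k ∧ k ≤ j ∧ p k = some i := by
  induction j using WellFoundedLT.induction generalizing i with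
  | _ j ih =>
    cases hj : p j with
    | none => exact absurd (h.trans (root_of_none hj) ▸ root_le hlt i) hij.not_ge
    | some l =>
      have hlj := hlt l j hj
      rw [root_of_some hj hlj] at h
      rcases lt_trichotomy l i with hli | rfl | hil
      · obtain ⟨k, -, hki, hk⟩ := ih i hij hli h.symm
        exact absurd hij (hinj l k j hk hj ▸ hki).not_gt
      · exact ⟨j, hlj, le_rfl, hj⟩
      · obtain ⟨k, hik, hkl, hk⟩ := ih l hlj hil h
        exact ⟨k, hik, hkl.trans hlj.le, hk⟩

lemma isArc_ofPred_iff {i j : Fin N} : IsArc (ofPred p) i j ↔ p j = some i := by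
  simp only [isArc_iff, part_ofPred_eq_iff]
  constructor
  · rintro ⟨hij, h_root, h_between⟩
    obtain ⟨k, hik, hkj, hk⟩ := exists_succ_of_root_eq hlt hinj hij h_root
    rcases hkj.lt_or_eq with hkj | rfl
    · exact absurd ⟨hik, hkj⟩ (h_between k ((root_of_some hk hik).trans h_root))
    · exact hk
  · intro h
    have hij := hlt i j h
    refine ⟨hij, (root_of_some h hij).symm, fun k hk ⟨hik, hkj⟩ => ?_⟩
    rw [root_of_some h hij] at hk
    obtain ⟨l, -, hlk, hl⟩ := exists_succ_of_root_eq hlt hinj hik hk.symm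
    exact hkj.not_ge (hinj i l j hl h ▸ hlk)

lemma pred_ofPred : pred (ofPred p) = p := by
  funext j
  ext i
  rw [pred_eq_some, isArc_ofPred_iff hlt hinj]

end PredecessorFunction

end Root

section Histories

variable {N : ℕ}

/-- The elements before `t` that are still waiting for their successor at `t`, in a sequence of
steps `σ`. -/
def openAt (σ : Fin N → Step N) (t : ℕ) : Finset (Fin N) :=
  {i | (i : ℕ) < t ∧ (σ i).2 = true ∧ ∀ j : Fin N, i < j → (j : ℕ) < t → (σ j).1 ≠ some i}

/-- All steps of `σ` are admissible, and no element remains open. -/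
def Valid (β : ℕ → ℕ) (σ : Fin N → Step N) : Prop :=
  (∀ t : Fin N, Admissible β t (openAt σ t) (σ t)) ∧ openAt σ N = ∅

instance (β : ℕ → ℕ) : DecidablePred (Valid (N := N) β) := fun _ =>
  inferInstanceAs (Decidable (_ ∧ _))

lemma openAt_zero (σ : Fin N → Step N) : openAt σ 0 = ∅ := by simp [openAt]

lemma openAt_succ (σ : Fin N → Step N) (t : Fin N) :
    openAt σ (t + 1) = nextOpen t (openAt σ t) (σ t) := by
  ext i
  simp only [nextOpen, openAt, Finset.mem_filter_univ]
  constructor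
  · rintro ⟨hit, h_succ, h_free⟩
    rcases Nat.lt_succ_iff_lt_or_eq.1 hit with hit | hit
    · exact Or.inl ⟨⟨hit, h_succ, fun j hij hjt => h_free j hij (by omega)⟩,
        h_free t hit (by omega)⟩
    · exact Or.inr ⟨hit, Fin.ext hit ▸ h_succ⟩
  · rintro (⟨⟨hit, h_succ, h_free⟩, h_ne⟩ | ⟨hit, h_succ⟩)
    · refine ⟨by omega, h_succ, fun j hij hjt => ?_⟩
      rcases Nat.lt_succ_iff_lt_or_eq.1 hjt with hjt | hjt
      · exact h_free j hij hjt
      · exact Fin.ext hjt ▸ h_ne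
    · exact ⟨by omega, Fin.ext hit ▸ h_succ, fun j hij hjt => by omega⟩

lemma sum_valid_eq_closingWeight {R : Type*} [CommRing R] (a b q : R) (β : ℕ → ℕ) :
    ∑ σ : Fin N → Step N with Valid β σ, ∏ j : Fin N, chosenWeight a b q (openAt σ j) (σ j) =
      closingWeight a b q β N 0 (∅ : Finset (Fin N)) := by
  rw [closingWeight, ← sum_prod_eq_transfer nextOpen _ _ N 0 ∅ openAt openAt_zero
    (by simpa using openAt_succ), Finset.sum_filter]
  refine Finset.sum_congr rfl fun σ _ => ?_
  simp only [Valid, stepWeight, zero_add, Finset.prod_ite_zero, Finset.mem_univ, true_imp_iff,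
    mul_ite, mul_one, mul_zero, ← ite_and, and_comm]

variable (π : SetPartition N)

open Classical in
/-- The history of a set partition: the predecessor of each element, and whether the element has a
successor. -/
noncomputable def history (j : Fin N) : Step N := (pred π j, decide (∃ l, IsArc π j l))

lemma history_fst (j : Fin N) : (history π j).1 = pred π j := rfl

lemma history_snd {j : Fin N} : (history π j).2 = true ↔ ∃ l, IsArc π j l := by simp [history]

lemma history_injective : Function.Injective (history : SetPartition N → _) := fun _ _ h =>
  pred_injective (funext fun j => congrArg Prod.fst (congrFun h j))

lemma mem_openAt_history {i : Fin N} {t : ℕ} :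
    i ∈ openAt (history π) t ↔ (i : ℕ) < t ∧ ∃ l : Fin N, IsArc π i l ∧ t ≤ (l : ℕ) := by
  simp only [openAt, Finset.mem_filter_univ, history_snd, history_fst, ne_eq, pred_eq_some]
  refine and_congr_right fun _ => ⟨?_, ?_⟩
  · rintro ⟨⟨l, hl⟩, h_free⟩
    exact ⟨l, hl, not_lt.1 fun hlt => h_free l hl.lt hlt hl⟩
  · rintro ⟨l, hl, htl⟩
    refine ⟨⟨l, hl⟩, fun j _ hjt hj => ?_⟩
    rw [hj.right_unique hl] at hjt
    omega

/-- No element is a singleton, and the arc ending at `j` starts before `β j`. -/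
def IsSeparated (β : ℕ → ℕ) : Prop :=
  ∀ j, ((∃ i, IsArc π i j) ∨ ∃ l, IsArc π j l) ∧ ∀ i, IsArc π i j → (i : ℕ) < β j

variable {π} {β : ℕ → ℕ}

lemma valid_history_iff : Valid β (history π) ↔ IsSeparated π β := by
  have openAt_end : openAt (history π) N = ∅ := by
    ext i
    simp only [mem_openAt_history, Finset.notMem_empty, iff_false]
    rintro ⟨-, l, -, hl⟩
    exact l.2.not_ge hl
  have pred_open {i j : Fin N} (h : IsArc π i j) : i ∈ openAt (history π) j :=
    (mem_openAt_history π).2 ⟨h.lt, j, h, le_rfl⟩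
  simp only [Valid, openAt_end, and_true, IsSeparated, Admissible, history_fst, history_snd,
    pred_eq_some, pred_eq_none, ← not_exists, ← or_iff_not_imp_left]
  refine forall_congr' fun j => and_congr_right fun _ => forall_congr' fun i => ?_
  exact ⟨fun h hi => (h hi).2, fun h hi => ⟨pred_open hi, h hi⟩⟩

lemma exists_history_eq {σ : Fin N → Step N} (hσ : Valid β σ) : ∃ π, history π = σ := by
  have pred_open (i j : Fin N) (h : (σ j).1 = some i) : i < j ∧ (σ i).2 = true ∧
      ∀ k : Fin N, i < k → k < j → (σ k).1 ≠ some i := by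
    simpa [openAt] using ((hσ.1 j).2 i h).1
  have hlt (i j : Fin N) (h : (σ j).1 = some i) : i < j := (pred_open i j h).1
  have hinj (i j j' : Fin N) (h : (σ j).1 = some i) (h' : (σ j').1 = some i) : j = j' := by
    by_contra! hne
    rcases hne.lt_or_gt with hjj | hjj
    · exact (pred_open i j' h').2.2 j (hlt i j h) hjj h
    · exact (pred_open i j h).2.2 j' (hlt i j' h') hjj h'
  have succ_iff (j : Fin N) : (∃ l, (σ l).1 = some j) ↔ (σ j).2 = true := by
    refine ⟨fun ⟨l, hl⟩ => (pred_open j l hl).2.1, fun hj => ?_⟩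
    by_contra! h_free
    have hj_open : j ∈ openAt σ N := by simp [openAt, hj, h_free]
    simp [hσ.2] at hj_open
  refine ⟨ofPred fun j => (σ j).1, funext fun j => Prod.ext ?_ ?_⟩
  · rw [history_fst, pred_ofPred hlt hinj]
  · rw [Bool.eq_iff_iff, history_snd, ← succ_iff]
    simp only [isArc_ofPred_iff hlt hinj]

lemma sum_isSeparated_eq_sum_valid {M : Type*} [AddCommMonoid M]
    [DecidablePred fun π : SetPartition N => IsSeparated π β] (f : (Fin N → Step N) → M) :
    ∑ π : SetPartition N with IsSeparated π β, f (history π) = ∑ σ with Valid β σ, f σ := by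
  refine Finset.sum_bij (fun π _ => history π) (fun π hπ => ?_)
    (fun _ _ _ _ h => history_injective h) (fun σ hσ => ?_) fun _ _ => rfl
  · simpa [valid_history_iff] using hπ
  · rw [Finset.mem_filter_univ] at hσ
    obtain ⟨π, rfl⟩ := exists_history_eq hσ
    exact ⟨π, by simpa [valid_history_iff] using hσ, rfl⟩

lemma isInhomogeneous_iff {m : ℕ} {n : Fin m → ℕ} {π : SetPartition (∑ i, n i)} :
    IsInhomogeneous n π ↔ IsSeparated π (currentStart n) := by
  constructor
  · intro h j
    refine ⟨?_, fun i hij => ?_⟩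
    · obtain ⟨k, hk, hkj⟩ := Finset.exists_mem_ne (h (π.part j) (by simp)).1 j
      have part_eq := (π.mem_part_iff_part_eq_part (Finset.mem_univ _) (Finset.mem_univ _)).1 hk
      rcases hkj.lt_or_gt with hlt | hlt
      · exact Or.inl ((exists_isArc_left hlt part_eq).imp fun _ => And.right)
      · exact Or.inr (exists_isArc_right hlt part_eq.symm)
    · by_contra! hle
      obtain ⟨k, hk⟩ := (exists_mem_box_iff n hij.lt).2 hle
      obtain ⟨hlt, B, hB, hi, hj, -⟩ := hij
      exact (h B hB).2 i hi j hj hlt.ne k hk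
  · intro h B hB
    have not_same_box (x : _) (hx : x ∈ B) (y : _) (hy : y ∈ B) (hxy : x < y) (j : Fin m) :
        ¬ (x ∈ box n j ∧ y ∈ box n j) := fun hj => by
      obtain ⟨i, hxi, hi⟩ := exists_isArc_left hxy ((part_eq_part_iff_mem hB hy).2 hx)
      have := (exists_mem_box_iff n hxy).1 ⟨j, hj⟩
      exact ((h y).2 i hi).not_ge (this.trans hxi)
    refine ⟨?_, fun x hx y hy hxy j hj => ?_⟩
    · obtain ⟨x, hx⟩ := π.nonempty_of_mem_parts hB
      rcases (h x).1 with ⟨i, hi⟩ | ⟨l, hl⟩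
      · exact Finset.one_lt_card.2 ⟨i, (part_eq_part_iff_mem hB hx).1 hi.part_eq, x, hx, hi.lt.ne⟩
      · exact Finset.one_lt_card.2
          ⟨x, hx, l, (part_eq_part_iff_mem hB hx).1 hl.part_eq.symm, hl.lt.ne⟩
    · rcases hxy.lt_or_gt with hlt | hlt
      · exact not_same_box x hx y hy hlt j hj
      · exact not_same_box y hy x hx hlt j hj.symm

end Histories

section Weight

variable {N : ℕ} (π : SetPartition N)

open Classical in
lemma tr_eq_card : tr π = Finset.card {j | (∃ i, IsArc π i j) ∧ ∃ l, IsArc π j l} := by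
  rw [tr]
  congr 1
  ext x
  simp only [Finset.mem_filter_univ]
  constructor
  · rintro ⟨B, hB, hx, ⟨y, hy, hyx⟩, ⟨z, hz, hxz⟩⟩
    exact ⟨(exists_isArc_left hyx ((part_eq_part_iff_mem hB hx).2 hy)).imp fun _ => And.right,
      exists_isArc_right hxz ((part_eq_part_iff_mem hB hx).2 hz).symm⟩
  · rintro ⟨⟨i, hi⟩, ⟨l, hl⟩⟩
    have hB : π.part x ∈ π.parts := by simp
    have hx : x ∈ π.part x := π.mem_part (Finset.mem_univ x)
    exact ⟨π.part x, hB, hx, ⟨i, (part_eq_part_iff_mem hB hx).1 hi.part_eq, hi.lt⟩,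
      ⟨l, (part_eq_part_iff_mem hB hx).1 hl.part_eq.symm, hl.lt⟩⟩

open Classical in
lemma bl_eq_card : bl π = Finset.card {j | ¬ ∃ l, IsArc π j l} := by
  rw [bl]
  symm
  refine Finset.card_bij (fun j _ => π.part j) (fun j _ => by simp) ?_ ?_
  · intro i hi j hj h
    rw [Finset.mem_filter_univ] at hi hj
    by_contra! hne
    rcases hne.lt_or_gt with hlt | hlt
    · exact hi (exists_isArc_right hlt h)
    · exact hj (exists_isArc_right hlt h.symm)
  · intro B hB
    have hne := π.nonempty_of_mem_parts hB
    have h_max := B.max'_mem hne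
    refine ⟨B.max' hne, ?_, π.part_eq_of_mem hB h_max⟩
    rw [Finset.mem_filter_univ]
    rintro ⟨l, hl⟩
    exact hl.lt.not_ge (B.le_max' l ((part_eq_part_iff_mem hB h_max).1 hl.part_eq.symm))

variable {π} in
lemma card_crossings_of_isArc {i j : Fin N} (hij : IsArc π i j) :
    Finset.card {e : (Fin N × Fin N) × (Fin N × Fin N) | (IsArc π e.1.1 e.1.2 ∧
      IsArc π e.2.1 e.2.2 ∧ e.1.1 < e.2.1 ∧ e.2.1 < e.1.2 ∧ e.1.2 < e.2.2) ∧ e.1.2 = j} =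
      Finset.card {k ∈ openAt (history π) j | i < k} := by
  refine Finset.card_bij (fun e _ => e.2.1) ?_ ?_ ?_
  · rintro ⟨⟨i', j'⟩, ⟨k, l⟩⟩ he
    rw [Finset.mem_filter_univ] at he
    obtain ⟨⟨hij', hkl, hik, hkj, hjl⟩, rfl⟩ := he
    obtain rfl := hij'.left_unique hij
    rw [Finset.mem_filter, mem_openAt_history]
    exact ⟨⟨hkj, l, hkl, hjl.le⟩, hik⟩
  · rintro ⟨⟨i₁, j₁⟩, ⟨k₁, l₁⟩⟩ h₁ ⟨⟨i₂, j₂⟩, ⟨k₂, l₂⟩⟩ h₂ rfl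
    simp only [Finset.mem_filter_univ] at h₁ h₂
    obtain ⟨⟨hij₁, hkl₁, -⟩, rfl⟩ := h₁
    obtain ⟨⟨hij₂, hkl₂, -⟩, rfl⟩ := h₂
    rw [hij₁.left_unique hij₂, hkl₁.right_unique hkl₂]
  · intro k hk
    rw [Finset.mem_filter, mem_openAt_history] at hk
    obtain ⟨⟨hkj, l, hkl, hjl⟩, hik⟩ := hk
    refine ⟨((i, j), (k, l)), ?_, rfl⟩
    rw [Finset.mem_filter_univ]
    refine ⟨⟨hij, hkl, hik, hkj, lt_of_le_of_ne hjl fun h => ?_⟩, rfl⟩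
    obtain rfl : j = l := h
    exact hik.ne (hij.left_unique hkl)

lemma cr_eq_sum_card : cr π = ∑ j : Fin N,
    (pred π j).elim 0 fun i => Finset.card {k ∈ openAt (history π) j | i < k} := by
  rw [cr, Finset.card_eq_sum_card_fiberwise (f := fun e => e.1.2) (t := Finset.univ)
    (by intro; simp)]
  refine Finset.sum_congr rfl fun j _ => ?_
  rw [Finset.filter_filter]
  cases h : pred π j with
  | none =>
    rw [pred_eq_none] at h
    rw [Option.elim_none, Finset.card_eq_zero, Finset.filter_eq_empty_iff]
    rintro e - ⟨⟨h_arc, -⟩, rfl⟩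
    exact h _ h_arc
  | some i => exact card_crossings_of_isArc (pred_eq_some.1 h)

lemma sg_eq_zero {m : ℕ} {n : Fin m → ℕ} {π : SetPartition (∑ i, n i)}
    (h : IsInhomogeneous n π) : sg π = 0 := by
  rw [sg, Finset.card_eq_zero, Finset.filter_eq_empty_iff]
  intro B hB
  have := (h B hB).1
  omega

variable {R : Type*} [CommRing R] (a b c q : R)

variable {π} in
open Classical in
lemma chosenWeight_history {β : ℕ → ℕ} (h : IsSeparated π β) (j : Fin N) :
    chosenWeight a b q (openAt (history π) j) (history π j) =
      (if ¬ ∃ l, IsArc π j l then a else 1) *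
        (if (∃ i, IsArc π i j) ∧ ∃ l, IsArc π j l then b else 1) *
        q ^ ((pred π j).elim 0 fun i => Finset.card {k ∈ openAt (history π) j | i < k}) := by
  rw [chosenWeight, history_fst]
  simp only [history_snd]
  cases hp : pred π j with
  | none =>
    have h_left : ¬ ∃ i, IsArc π i j := not_exists.2 (pred_eq_none.1 hp)
    have h_right : ∃ l, IsArc π j l := (h j).1.resolve_left h_left
    simp only [Option.elim_none, h_left, h_right, not_true_eq_false, false_and, if_false, pow_zero,
      mul_one]
  | some i =>
    have h_left : ∃ i, IsArc π i j := ⟨i, pred_eq_some.1 hp⟩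
    by_cases h_right : ∃ l, IsArc π j l <;>
      simp only [Option.elim_some, h_left, h_right, not_true_eq_false, not_false_eq_true, and_self,
        and_false, if_true, if_false, one_mul, mul_one]

lemma weight_eq_prod {m : ℕ} {n : Fin m → ℕ} {π : SetPartition (∑ i, n i)}
    (h : IsInhomogeneous n π) :
    weight a b c q π =
      ∏ j : Fin (∑ i, n i), chosenWeight a b q (openAt (history π) j) (history π j) := by
  classical
  rw [Finset.prod_congr rfl fun j _ => chosenWeight_history a b q (isInhomogeneous_iff.1 h) j,
    Finset.prod_mul_distrib, Finset.prod_mul_distrib, Finset.prod_pow_eq_pow_sum, ← cr_eq_sum_card,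
    Finset.prod_ite, Finset.prod_ite]
  simp only [Finset.prod_const, one_pow, mul_one]
  rw [← bl_eq_card, ← tr_eq_card, weight, sg_eq_zero h, pow_zero, mul_one]

lemma F_eq_closingWeight {m : ℕ} (n : Fin m → ℕ) :
    F a b c q n = closingWeight a b q (currentStart n) (∑ i, n i) 0
      (∅ : Finset (Fin (∑ i, n i))) := by
  classical
  rw [← sum_valid_eq_closingWeight, ← sum_isSeparated_eq_sum_valid fun σ =>
    ∏ j : Fin (∑ i, n i), chosenWeight a b q (openAt σ j) (σ j), F]
  refine Finset.sum_congr (Finset.filter_congr fun _ _ => isInhomogeneous_iff) fun π hπ => ?_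
  exact weight_eq_prod a b c q (isInhomogeneous_iff.2 ((Finset.mem_filter_univ π).1 hπ))

open Polynomial in
theorem F_eq_apply_prod_charlier {a b c q : R} {L : R[X] →ₗ[R] R}
    (hL : IsOrthogonalityFunctional a b c q L) {m : ℕ} (n : Fin m → ℕ) :
    F a b c q n = L (∏ j, charlier a b c q (n j)) := by
  rw [F_eq_closingWeight, closingWeight_eq_apply_prod_charlier n hL]

end Weight

/-! ### Continuous big `q`-Hermite polynomials -/

section Hermite

open Polynomial

variable {R : Type*} [CommRing R] (q α : R)

/-- The continuous `q`-Hermite polynomials, in the variable `x = 2 cos θ`. -/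
noncomputable abbrev qHermite (n : ℕ) : R[X] := charlier (1 - q) 0 0 q n

/-- The continuous big `q`-Hermite polynomials with parameter `α`, in the variable
`x = 2 cos θ`. -/
noncomputable abbrev bigQHermite (n : ℕ) : R[X] := charlier (1 - q) (-α * (1 - q)) α q n

lemma threeTermRecurrence_qHermite :
    ThreeTermRecurrence (qHermite q) (fun _ => 0) fun n => 1 - q ^ n := by
  simpa only [zero_mul, zero_add, one_sub_mul_qInt] using threeTermRecurrence_charlier (1 - q) 0 0 q

lemma threeTermRecurrence_bigQHermite :
    ThreeTermRecurrence (bigQHermite q α) (fun n => α * q ^ n) fun n => 1 - q ^ n := by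
  have hβ (n : ℕ) : α + -α * (1 - q) * qInt q n = α * q ^ n := by
    rw [mul_assoc, one_sub_mul_qInt]
    ring
  simpa only [hβ, one_sub_mul_qInt] using
    threeTermRecurrence_charlier (1 - q) (-α * (1 - q)) α q

/-- The falling `q`-factorial `(1 - q ^ j) (1 - q ^ (j - 1)) ⋯ (1 - q ^ (j - n + 1))`, which
vanishes for `j < n`. -/
def qFalling (n j : ℕ) : R := ∏ i ∈ Finset.range n, (1 - q ^ (j - i))

@[simp] lemma qFalling_zero (j : ℕ) : qFalling q 0 j = 1 := by simp [qFalling]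

lemma qFalling_eq_zero {n j : ℕ} (h : j < n) : qFalling q n j = 0 :=
  Finset.prod_eq_zero (Finset.mem_range.2 h) (by simp)

lemma qFalling_succ (n j : ℕ) : qFalling q (n + 1) j = qFalling q n j * (1 - q ^ (j - n)) :=
  Finset.prod_range_succ _ _

lemma qFalling_succ_succ (n j : ℕ) :
    qFalling q (n + 1) (j + 1) = (1 - q ^ (j + 1)) * qFalling q n j := by
  rw [qFalling, Finset.prod_range_succ', mul_comm]
  simp [qFalling]

lemma pow_mul_qFalling_succ_left (n j : ℕ) :
    α ^ (j - (n + 1)) * qFalling q (n + 1) j =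
      (1 - q ^ j) * (α ^ (j - 1 - n) * qFalling q n (j - 1)) := by
  cases j with
  | zero => simp [qFalling_eq_zero q (Nat.succ_pos n)]
  | succ j =>
    rw [qFalling_succ_succ, Nat.add_sub_cancel, Nat.add_sub_add_right]
    ring

lemma pow_mul_qFalling_succ_right (n j : ℕ) :
    α ^ (j + 1 - n) * qFalling q n (j + 1) =
      α * q ^ n * (α ^ (j - n) * qFalling q n j) +
        (1 - q ^ n) * (α ^ (j - (n - 1)) * qFalling q (n - 1) j) := by
  cases n with
  | zero => simp [pow_succ']
  | succ n =>
    rw [qFalling_succ_succ, qFalling_succ, Nat.add_sub_cancel, Nat.add_sub_add_right]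
    rcases lt_trichotomy j n with hjn | rfl | hnj
    · simp [qFalling_eq_zero q hjn]
    · simp
    · obtain ⟨d, rfl⟩ := Nat.exists_eq_add_of_lt hnj
      rw [show n + d + 1 - n = d + 1 by omega, show n + d + 1 - (n + 1) = d by omega]
      ring

variable {q α} {L : R[X] →ₗ[R] R} (hL : ∀ j, L (qHermite q j) = α ^ j)
include hL

lemma apply_qHermite_mul_bigQHermite (j n : ℕ) :
    L (qHermite q j * bigQHermite q α n) = α ^ (j - n) * qFalling q n j := by
  induction n using Nat.strong_induction_on generalizing j with
  | _ n ih =>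
    cases n with
    | zero => rw [(threeTermRecurrence_bigQHermite q α).zero, mul_one, hL]; simp
    | succ n =>
      rw [(threeTermRecurrence_qHermite q).mul_succ_eq (threeTermRecurrence_bigQHermite q α)]
      simp only [map_add, map_sub, map_smul, smul_eq_mul]
      rw [ih n (by omega), ih n (by omega), ih n (by omega), ih (n - 1) (by omega)]
      linear_combination
        pow_mul_qFalling_succ_right q α n j - pow_mul_qFalling_succ_left q α n j

lemma apply_bigQHermite (n : ℕ) : L (bigQHermite q α n) = if n = 0 then 1 else 0 := by
  have h_zero := apply_qHermite_mul_bigQHermite hL 0 n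
  rw [(threeTermRecurrence_qHermite q).zero, one_mul] at h_zero
  rw [h_zero]
  split_ifs with hn
  · simp [hn]
  · rw [qFalling_eq_zero q (Nat.pos_of_ne_zero hn), mul_zero]

end Hermite

section QPochhammer

variable {R : Type*} [CommRing R]

/-- The finite `q`-Pochhammer symbol `(q; q)_n`. -/
def qPoch (q : R) (n : ℕ) : R := ∏ i ∈ Finset.range n, (1 - q ^ (i + 1))

@[simp] lemma qPoch_zero (q : R) : qPoch q 0 = 1 := Finset.prod_range_zero _

lemma qPoch_succ (q : R) (n : ℕ) : qPoch q (n + 1) = qPoch q n * (1 - q ^ (n + 1)) :=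
  Finset.prod_range_succ _ _

variable {q : ℝ} (hq : |q| < 1)
include hq

lemma one_sub_pow_pos {n : ℕ} (hn : n ≠ 0) : 0 < 1 - q ^ n :=
  sub_pos.2 <| (le_abs_self _).trans_lt <| abs_pow q n ▸ pow_lt_one₀ (abs_nonneg q) hq hn

lemma qPoch_ne_zero (n : ℕ) : qPoch q n ≠ 0 :=
  Finset.prod_ne_zero_iff.2 fun i _ => (one_sub_pow_pos hq i.succ_ne_zero).ne'

lemma inv_qPoch_succ_mul (n : ℕ) : (qPoch q (n + 1))⁻¹ * (1 - q ^ (n + 1)) = (qPoch q n)⁻¹ := by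
  have h_pos := one_sub_pow_pos hq n.succ_ne_zero
  rw [qPoch_succ, mul_inv, inv_mul_cancel_right₀ h_pos.ne']

lemma summable_norm_neg_pow_succ : Summable fun k : ℕ => ‖-q ^ (k + 1)‖ := by
  simpa only [norm_neg] using (summable_nat_add_iff 1).2 (summable_geometric_of_abs_lt_one hq).norm

lemma qPochInf_ne_zero : qPochInf q ≠ 0 := by
  simp only [qPochInf, sub_eq_add_neg]
  refine tprod_one_add_ne_zero_of_summable (fun k => ?_) (summable_norm_neg_pow_succ hq)
  simpa only [← sub_eq_add_neg] using (one_sub_pow_pos hq k.succ_ne_zero).ne'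

lemma tendsto_qPoch : Filter.Tendsto (qPoch q) Filter.atTop (nhds (qPochInf q)) := by
  unfold qPoch qPochInf
  simpa only [sub_eq_add_neg] using
    (multipliable_one_add_of_summable (summable_norm_neg_pow_succ hq)).hasProd.tendsto_prod_nat

lemma exists_abs_inv_qPoch_le : ∃ C : ℝ, 0 ≤ C ∧ ∀ n, |(qPoch q n)⁻¹| ≤ C := by
  obtain ⟨C, hC⟩ := ((tendsto_qPoch hq).inv₀ (qPochInf_ne_zero hq)).abs.bddAbove_range
  exact ⟨C, (abs_nonneg _).trans (hC ⟨0, rfl⟩), fun n => hC ⟨n, rfl⟩⟩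

end QPochhammer

/-! ### The generating function of the continuous `q`-Hermite polynomials -/

section HermiteFun

open Finset Real

/-- The convolution `∑_{k + l = n} f k l / ((q; q)_k (q; q)_l)`. -/
noncomputable def qConv (q : ℝ) (n : ℕ) (f : ℕ → ℕ → ℝ) : ℝ :=
  ∑ p ∈ antidiagonal n, (qPoch q p.1)⁻¹ * (qPoch q p.2)⁻¹ * f p.1 p.2

/-- The normalized continuous `q`-Hermite polynomial `H_n(cos θ | q) / (q; q)_n`, given by its
Fourier expansion. -/
noncomputable def hermiteFun (q : ℝ) (n : ℕ) (θ : ℝ) : ℝ :=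
  qConv q n fun k l => cos (((k : ℝ) - l) * θ)

section

variable (q : ℝ) (n : ℕ)

lemma qConv_add (f g : ℕ → ℕ → ℝ) :
    qConv q n (fun k l => f k l + g k l) = qConv q n f + qConv q n g := by
  simp only [qConv, mul_add, sum_add_distrib]

lemma qConv_sub (f g : ℕ → ℕ → ℝ) :
    qConv q n (fun k l => f k l - g k l) = qConv q n f - qConv q n g := by
  simp only [qConv, mul_sub, sum_sub_distrib]

lemma qConv_const_mul (r : ℝ) (f : ℕ → ℕ → ℝ) :
    qConv q n (fun k l => r * f k l) = r * qConv q n f := by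
  simp only [qConv, mul_sum, mul_left_comm]

variable {n} in
lemma qConv_congr {f g : ℕ → ℕ → ℝ} (h : ∀ k l, k + l = n → f k l = g k l) :
    qConv q n f = qConv q n g :=
  sum_congr rfl fun p hp => by rw [h p.1 p.2 (mem_antidiagonal.1 hp)]

@[simp] lemma qConv_zero (f : ℕ → ℕ → ℝ) : qConv q 0 f = f 0 0 := by simp [qConv]

@[simp] lemma hermiteFun_zero (θ : ℝ) : hermiteFun q 0 θ = 1 := by simp [hermiteFun]

lemma continuous_hermiteFun : Continuous (hermiteFun q n) := by
  unfold hermiteFun qConv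
  fun_prop

end

variable {q : ℝ} (hq : |q| < 1)
include hq

lemma qConv_one_sub_pow_left (n : ℕ) (f : ℕ → ℕ → ℝ) :
    qConv q (n + 1) (fun k l => (1 - q ^ k) * f k l) = qConv q n fun k l => f (k + 1) l := by
  rw [qConv, Nat.sum_antidiagonal_succ, qConv]
  simp only [pow_zero, sub_self, zero_mul, mul_zero, zero_add]
  refine sum_congr rfl fun p _ => ?_
  rw [← inv_qPoch_succ_mul hq p.1]
  ring

lemma qConv_one_sub_pow_right (n : ℕ) (f : ℕ → ℕ → ℝ) :
    qConv q (n + 1) (fun k l => (1 - q ^ l) * f k l) = qConv q n fun k l => f k (l + 1) := by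
  rw [qConv, Nat.sum_antidiagonal_succ', qConv]
  simp only [pow_zero, sub_self, zero_mul, mul_zero, zero_add]
  refine sum_congr rfl fun p _ => ?_
  rw [← inv_qPoch_succ_mul hq p.2]
  ring

/-- The `q`-Pascal rule, from `1 - q ^ (k + l) = (1 - q ^ k) + q ^ k (1 - q ^ l)`. -/
lemma one_sub_pow_mul_qConv_succ (n : ℕ) (f : ℕ → ℕ → ℝ) :
    (1 - q ^ (n + 1)) * qConv q (n + 1) f =
      qConv q n fun k l => f (k + 1) l + q ^ k * f k (l + 1) := by
  rw [qConv_add, ← qConv_one_sub_pow_left hq,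
    ← qConv_one_sub_pow_right hq n (fun k l => q ^ k * f k l), ← qConv_add, ← qConv_const_mul]
  refine qConv_congr q fun k l h => ?_
  rw [← h, pow_add]
  ring

lemma one_sub_mul_hermiteFun_one (θ : ℝ) : (1 - q) * hermiteFun q 1 θ = 2 * cos θ := by
  have h_pascal := one_sub_pow_mul_qConv_succ hq 0 fun k l => cos (((k : ℝ) - l) * θ)
  rw [zero_add, pow_one, qConv_zero] at h_pascal
  rw [hermiteFun, h_pascal]
  simp
  ring

lemma one_sub_pow_mul_hermiteFun (n : ℕ) (θ : ℝ) :
    (1 - q ^ (n + 2)) * hermiteFun q (n + 2) θ =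
      2 * cos θ * hermiteFun q (n + 1) θ - hermiteFun q n θ := by
  have h_lower : hermiteFun q n θ =
      qConv q (n + 1) fun k l => (1 - q ^ k) * cos (((k : ℝ) - l) * θ - θ) := by
    rw [qConv_one_sub_pow_left hq n fun k l => cos (((k : ℝ) - l) * θ - θ), hermiteFun]
    refine qConv_congr q fun k l _ => ?_
    push_cast
    ring_nf
  rw [h_lower, hermiteFun, hermiteFun, one_sub_pow_mul_qConv_succ hq, ← qConv_const_mul,
    ← qConv_sub]
  refine qConv_congr q fun k l _ => ?_
  have h_up : (((k + 1 : ℕ) : ℝ) - l) * θ = ((k : ℝ) - l) * θ + θ := by push_cast; ring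
  have h_down : ((k : ℝ) - (l + 1 : ℕ)) * θ = ((k : ℝ) - l) * θ - θ := by push_cast; ring
  rw [h_up, h_down, cos_add, cos_sub]
  ring

lemma eval_qHermite (n : ℕ) (θ : ℝ) :
    (qHermite q n).eval (2 * cos θ) = qPoch q n * hermiteFun q n θ := by
  induction n using Nat.twoStepInduction with
  | zero => simp [(threeTermRecurrence_qHermite q).zero]
  | one => simp [charlier, qPoch_succ, one_sub_mul_hermiteFun_one hq]
  | more n ih ih' =>
    have h_rec := congrArg (Polynomial.eval (2 * cos θ))
      ((threeTermRecurrence_qHermite q).X_mul (n + 1))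
    simp only [Polynomial.eval_mul, Polynomial.eval_X, Polynomial.eval_add, Polynomial.eval_C,
      Nat.add_sub_cancel, ih, ih'] at h_rec
    linear_combination -h_rec - qPoch q (n + 1) * one_sub_pow_mul_hermiteFun hq n θ +
      hermiteFun q n θ * qPoch_succ q n - hermiteFun q (n + 2) θ * qPoch_succ q (n + 1)

lemma exists_abs_hermiteFun_le :
    ∃ C : ℝ, ∀ n θ, |hermiteFun q n θ| ≤ C * ((n : ℝ) + 1) := by
  obtain ⟨C, hC_nonneg, hC⟩ := exists_abs_inv_qPoch_le hq
  refine ⟨C * C, fun n θ => ?_⟩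
  calc |hermiteFun q n θ|
      ≤ ∑ p ∈ antidiagonal n,
          |(qPoch q p.1)⁻¹ * (qPoch q p.2)⁻¹ * cos (((p.1 : ℝ) - p.2) * θ)| :=
        by unfold hermiteFun qConv; exact abs_sum_le_sum_abs _ _
    _ ≤ ∑ _p ∈ antidiagonal n, C * C * 1 := by
        gcongr with p
        rw [abs_mul, abs_mul]
        gcongr
        exacts [hC _, hC _, abs_cos_le_one _]
    _ = C * C * ((n : ℝ) + 1) := by simp [mul_comm]

end HermiteFun

section GeneratingFunction

open Filter Real Set
open scoped Topology

/-- The generating function `∑ H_n(cos θ | q) β ^ n / (q; q)_n` of the continuous `q`-Hermite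
polynomials. -/
noncomputable def hermiteGen (q β θ : ℝ) : ℝ := ∑' n, hermiteFun q n θ * β ^ n

/-- The squared modulus of `1 - β e ^ (i θ)`. -/
noncomputable def sqDist (β θ : ℝ) : ℝ := 1 - 2 * β * cos θ + β ^ 2

/-- The squared modulus of `(β e ^ (i θ); q)_∞`. -/
noncomputable def sqProd (q β θ : ℝ) : ℝ := ∏' k : ℕ, sqDist (β * q ^ k) θ

lemma abs_sqDist_le (β θ : ℝ) : |sqDist β θ| ≤ (1 + |β|) ^ 2 := by
  have h_cross : |β * cos θ| ≤ |β| := by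
    rw [abs_mul]
    exact mul_le_of_le_one_right (abs_nonneg β) (abs_cos_le_one θ)
  rw [abs_le] at h_cross ⊢
  rw [sqDist, add_sq, sq_abs]
  constructor <;> nlinarith [sq_nonneg β]

@[simp] lemma hermiteGen_zero (q θ : ℝ) : hermiteGen q 0 θ = 1 := by
  rw [hermiteGen, tsum_eq_single 0 fun n hn => by simp [hn]]
  simp

lemma summable_const_mul_succ_mul_pow {r : ℝ} (hr₀ : 0 ≤ r) (hr₁ : r < 1) (C : ℝ) :
    Summable fun n : ℕ => C * ((n : ℝ) + 1) * r ^ n := by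
  have h_norm : ‖r‖ < 1 := by rwa [norm_of_nonneg hr₀]
  refine (((summable_pow_mul_geometric_of_norm_lt_one 1 h_norm).add
    (summable_geometric_of_norm_lt_one h_norm)).mul_left C).congr fun n => ?_
  ring

variable {q : ℝ} (hq : |q| < 1)
include hq

lemma abs_mul_lt_one {β : ℝ} (hβ : |β| ≤ 1) : |q * β| < 1 := by
  rw [abs_mul]
  exact mul_lt_one_of_nonneg_of_lt_one_left (abs_nonneg _) hq hβ

lemma exists_hermiteGen_majorant {r : ℝ} (hr₀ : 0 ≤ r) (hr₁ : r < 1) : ∃ u : ℕ → ℝ, Summable u ∧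
    ∀ n θ β, |β| ≤ r → ‖hermiteFun q n θ * β ^ n‖ ≤ u n := by
  obtain ⟨C, hC⟩ := exists_abs_hermiteFun_le hq
  refine ⟨_, summable_const_mul_succ_mul_pow hr₀ hr₁ C, fun n θ β hβ => ?_⟩
  rw [norm_mul, norm_pow]
  gcongr
  · exact (abs_nonneg _).trans (hC n θ)
  · exact hC n θ
  · exact hβ

lemma summable_hermiteGen {β : ℝ} (hβ : |β| < 1) (θ : ℝ) :
    Summable fun n => hermiteFun q n θ * β ^ n := by
  obtain ⟨u, hu, h_le⟩ := exists_hermiteGen_majorant hq (abs_nonneg β) hβ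
  exact hu.of_norm_bounded fun n => h_le n θ β le_rfl

lemma continuous_hermiteGen {β : ℝ} (hβ : |β| < 1) : Continuous (hermiteGen q β) := by
  obtain ⟨u, hu, h_le⟩ := exists_hermiteGen_majorant hq (abs_nonneg β) hβ
  exact continuous_tsum (fun n => (continuous_hermiteFun q n).mul continuous_const) hu
    fun n θ => h_le n θ β le_rfl

lemma continuousOn_hermiteGen {r : ℝ} (hr₀ : 0 ≤ r) (hr₁ : r < 1) (θ : ℝ) :
    ContinuousOn (fun β => hermiteGen q β θ) (Icc (-r) r) := by
  obtain ⟨u, hu, h_le⟩ := exists_hermiteGen_majorant hq hr₀ hr₁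
  exact continuousOn_tsum (fun n => by fun_prop) hu fun n β hβ => h_le n θ β (abs_le.2 hβ)

lemma exists_abs_hermiteGen_le {r : ℝ} (hr₀ : 0 ≤ r) (hr₁ : r < 1) :
    ∃ C, ∀ θ β, |β| ≤ r → |hermiteGen q β θ| ≤ C := by
  obtain ⟨u, hu, h_le⟩ := exists_hermiteGen_majorant hq hr₀ hr₁
  exact ⟨∑' n, u n, fun θ β hβ => tsum_of_norm_bounded hu.hasSum fun n => h_le n θ β hβ⟩

lemma hermiteGen_mul_left {β : ℝ} (hβ : |β| < 1) (θ : ℝ) :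
    hermiteGen q (q * β) θ = sqDist β θ * hermiteGen q β θ := by
  let a (n : ℕ) : ℝ := hermiteFun q n θ * β ^ n
  have ha : Summable a := summable_hermiteGen hq hβ θ
  have ha' : Summable fun n => a (n + 1) := (summable_nat_add_iff 1).2 ha
  have hqa (n : ℕ) : hermiteFun q n θ * (q * β) ^ n = q ^ n * a n := by
    rw [mul_pow]
    ring
  have h_summable : Summable fun n => q ^ n * a n := by
    simpa only [hqa] using summable_hermiteGen hq (abs_mul_lt_one hq hβ.le) θ
  have h_rec (n : ℕ) :
      (1 - q ^ (n + 2)) * a (n + 2) = 2 * β * cos θ * a (n + 1) - β ^ 2 * a n := by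
    linear_combination β ^ (n + 2) * one_sub_pow_mul_hermiteFun hq n θ
  have h_diff : Summable fun n => (1 - q ^ n) * a n :=
    (ha.sub h_summable).congr fun n => by ring
  have h_sub : hermiteGen q β θ - hermiteGen q (q * β) θ = ∑' n, (1 - q ^ n) * a n := by
    simp only [hermiteGen, hqa]
    rw [← ha.tsum_sub h_summable]
    exact tsum_congr fun n => by ring
  have h_sum : ∑' n, (1 - q ^ n) * a n =
      2 * β * cos θ * hermiteGen q β θ - β ^ 2 * hermiteGen q β θ := calc
    _ = 2 * β * cos θ * a 0 + ∑' n, (2 * β * cos θ * a (n + 1) - β ^ 2 * a n) := by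
      rw [← h_diff.sum_add_tsum_nat_add 2]
      simp only [h_rec, Finset.sum_range_succ, Finset.sum_range_zero, a, hermiteFun_zero]
      linear_combination β * one_sub_mul_hermiteFun_one hq θ
    _ = 2 * β * cos θ * (a 0 + ∑' n, a (n + 1)) - β ^ 2 * ∑' n, a n := by
      rw [(ha'.mul_left _).tsum_sub (ha.mul_left _), tsum_mul_left, tsum_mul_left]
      ring
    _ = _ := by rw [← ha.tsum_eq_zero_add]; rfl
  rw [sqDist]
  linear_combination -h_sub - h_sum

lemma multipliable_sqDist (β θ : ℝ) : Multipliable fun k : ℕ => sqDist (β * q ^ k) θ := by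
  have hq_sq : |q ^ 2| < 1 := abs_pow q 2 ▸ pow_lt_one₀ (abs_nonneg q) hq two_ne_zero
  have h_summable := ((summable_geometric_of_abs_lt_one hq).mul_left (-(2 * β * cos θ))).add
    ((summable_geometric_of_abs_lt_one hq_sq).mul_left (β ^ 2))
  refine (multipliable_one_add_of_summable h_summable.norm).congr fun k => ?_
  rw [sqDist]
  ring

lemma tendsto_prod_sqDist (β θ : ℝ) :
    Tendsto (fun N => ∏ k ∈ Finset.range N, sqDist (β * q ^ k) θ) atTop (𝓝 (sqProd q β θ)) :=
  (multipliable_sqDist hq β θ).hasProd.tendsto_prod_nat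

lemma sqProd_eq_sqDist_mul (β θ : ℝ) : sqProd q β θ = sqDist β θ * sqProd q (q * β) θ := by
  have h_shift (k : ℕ) : sqDist (β * q ^ (k + 1)) θ = sqDist (q * β * q ^ k) θ := by
    rw [pow_succ', ← mul_assoc, mul_comm β q]
  have h_tail := (tendsto_prod_sqDist hq (q * β) θ).const_mul (sqDist β θ)
  refine tendsto_nhds_unique ((tendsto_prod_sqDist hq β θ).comp (tendsto_add_atTop_nat 1))
    (h_tail.congr fun N => ?_)
  simp only [Function.comp_apply, Finset.prod_range_succ', h_shift, pow_zero, mul_one, mul_comm]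

lemma prod_sqDist_mul_hermiteGen {β : ℝ} (hβ : |β| < 1) (θ : ℝ) (N : ℕ) :
    (∏ k ∈ Finset.range N, sqDist (β * q ^ k) θ) * hermiteGen q β θ =
      hermiteGen q (β * q ^ N) θ := by
  induction N with
  | zero => simp
  | succ N ih =>
    have h_lt : |β * q ^ N| < 1 := by
      rw [abs_mul, abs_pow]
      exact mul_lt_one_of_nonneg_of_lt_one_left (abs_nonneg _) hβ (pow_le_one₀ (abs_nonneg q) hq.le)
    rw [Finset.prod_range_succ, mul_right_comm, ih, mul_comm, ← hermiteGen_mul_left hq h_lt,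
      pow_succ', mul_left_comm]

lemma sqProd_mul_hermiteGen {β : ℝ} (hβ : |β| < 1) (θ : ℝ) :
    sqProd q β θ * hermiteGen q β θ = 1 := by
  have h_mem (N : ℕ) : β * q ^ N ∈ Icc (-|β|) |β| := by
    rw [mem_Icc, ← abs_le, abs_mul, abs_pow]
    exact mul_le_of_le_one_right (abs_nonneg _) (pow_le_one₀ (abs_nonneg q) hq.le)
  have h_arg : Tendsto (fun N : ℕ => β * q ^ N) atTop (𝓝[Icc (-|β|) |β|] 0) := by
    refine tendsto_nhdsWithin_iff.2 ⟨?_, Eventually.of_forall h_mem⟩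
    simpa using (tendsto_pow_atTop_nhds_zero_of_abs_lt_one hq).const_mul β
  have h_lim : Tendsto (fun N : ℕ => hermiteGen q (β * q ^ N) θ) atTop (𝓝 1) := by
    simpa [Function.comp_def] using
      (continuousOn_hermiteGen hq (abs_nonneg β) hβ θ 0 (by simp)).tendsto.comp h_arg
  refine tendsto_nhds_unique ((tendsto_prod_sqDist hq β θ).mul_const _) ?_
  simpa only [prod_sqDist_mul_hermiteGen hq hβ] using h_lim

lemma hermiteGen_ne_zero {β : ℝ} (hβ : |β| < 1) (θ : ℝ) : hermiteGen q β θ ≠ 0 :=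
  right_ne_zero_of_mul_eq_one (sqProd_mul_hermiteGen hq hβ θ)

lemma sqProd_eq_sqDist_mul_inv {β : ℝ} (hβ : |β| ≤ 1) (θ : ℝ) :
    sqProd q β θ = sqDist β θ * (hermiteGen q (q * β) θ)⁻¹ := by
  rw [sqProd_eq_sqDist_mul hq,
    eq_inv_of_mul_eq_one_left (sqProd_mul_hermiteGen hq (abs_mul_lt_one hq hβ) θ)]

end GeneratingFunction

/-! ### Finite theta products -/

section Theta

open Filter
open scoped Topology

/-- The coefficients `(-1) ^ i q ^ (i (i - 1) / 2)` of a theta function. -/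
noncomputable def thetaSeq (q : ℝ) (i : ℤ) : ℝ := (-1) ^ i * q ^ (i * (i - 1) / 2).toNat

/-- `1 / (q; q)_k`, extended by zero to negative `k`. -/
noncomputable def invQPoch (q : ℝ) (k : ℤ) : ℝ := if 0 ≤ k then (qPoch q k.toNat)⁻¹ else 0

/-- The coefficient of `w ^ i` in the finite theta product
`∏_{k < M} (1 - q ^ k w) ∏_{0 < k ≤ N} (1 - q ^ k / w)`, by the finite Jacobi triple product
identity. -/
noncomputable def thetaCoeff (q : ℝ) (M N : ℕ) (i : ℤ) : ℝ :=
  thetaSeq q i * qPoch q (M + N) * invQPoch q (M - i) * invQPoch q (N + i)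

section

variable (q : ℝ)

lemma pow_mul_thetaSeq_succ {A B : ℕ} {i : ℤ} (h : (A : ℤ) + i = B) :
    q ^ A * thetaSeq q (i + 1) = -(q ^ B * thetaSeq q i) := by
  have h_nonneg (j : ℤ) : 0 ≤ j * (j - 1) / 2 := by
    refine Int.ediv_nonneg ?_ (by norm_num)
    rcases le_or_gt j 0 with hj | hj
    · exact mul_nonneg_of_nonpos_of_nonpos hj (by omega)
    · exact mul_nonneg hj.le (by omega)
  have h_div : (i + 1) * (i + 1 - 1) / 2 = i * (i - 1) / 2 + i := by
    rw [show (i + 1) * (i + 1 - 1) = i * (i - 1) + i * 2 by ring,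
      Int.add_mul_ediv_right _ _ (by norm_num)]
  have h_exp : A + ((i + 1) * (i + 1 - 1) / 2).toNat = B + (i * (i - 1) / 2).toNat := by
    zify
    rw [Int.toNat_of_nonneg (h_nonneg i), Int.toNat_of_nonneg (h_nonneg (i + 1)), h_div]
    omega
  rw [thetaSeq, thetaSeq, zpow_add_one₀ (by norm_num)]
  calc _ = -((-1) ^ i * q ^ (A + ((i + 1) * (i + 1 - 1) / 2).toNat)) := by rw [pow_add]; ring
    _ = _ := by rw [h_exp, pow_add]; ring

lemma invQPoch_of_neg {k : ℤ} (hk : k < 0) : invQPoch q k = 0 := if_neg hk.not_ge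

lemma invQPoch_natCast (n : ℕ) : invQPoch q n = (qPoch q n)⁻¹ := by simp [invQPoch]

end

variable {q : ℝ} (hq : |q| < 1)
include hq

lemma invQPoch_sub_one (k : ℤ) : invQPoch q (k - 1) = (1 - q ^ k.toNat) * invQPoch q k := by
  rcases lt_or_ge k 0 with hk | hk
  · rw [invQPoch_of_neg q hk, invQPoch_of_neg q (by omega), mul_zero]
  · lift k to ℕ using hk
    cases k with
    | zero => simp [invQPoch]
    | succ n =>
      rw [Int.toNat_natCast, invQPoch_natCast, mul_comm, inv_qPoch_succ_mul hq,
        ← invQPoch_natCast, Nat.cast_succ, add_sub_cancel_right]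

/-- The `q`-Pascal rule: with `(q; q)_n`, the products of two reciprocals are `q`-binomial
coefficients. -/
lemma qPoch_succ_mul_invQPoch_mul_invQPoch {n : ℕ} {p r : ℤ} (h : p + r = n + 1) :
    qPoch q (n + 1) * (invQPoch q p * invQPoch q r) =
      qPoch q n * (invQPoch q (p - 1) * invQPoch q r) +
        q ^ p.toNat * (qPoch q n * (invQPoch q p * invQPoch q (r - 1))) := by
  rw [invQPoch_sub_one hq, invQPoch_sub_one hq]
  rcases lt_or_ge p 0 with hp | hp
  · simp [invQPoch_of_neg q hp]
  rcases lt_or_ge r 0 with hr | hr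
  · simp [invQPoch_of_neg q hr]
  rw [qPoch_succ, show n + 1 = p.toNat + r.toNat by omega, pow_add]
  ring

lemma thetaCoeff_succ_left (M N : ℕ) (i : ℤ) :
    thetaCoeff q (M + 1) N i = thetaCoeff q M N i - q ^ M * thetaCoeff q M N (i - 1) := by
  have h_pascal := qPoch_succ_mul_invQPoch_mul_invQPoch hq (n := M + N) (p := M + 1 - i)
    (r := N + i) (by push_cast; ring)
  have h_theta : q ^ (M + 1 - i : ℤ).toNat * thetaSeq q i * invQPoch q (M + 1 - i) =
      -(q ^ M * thetaSeq q (i - 1)) * invQPoch q (M + 1 - i) := by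
    rcases lt_or_ge (M + 1 - i : ℤ) 0 with hi | hi
    · simp [invQPoch_of_neg q hi]
    · rw [← pow_mul_thetaSeq_succ q (A := (M + 1 - i : ℤ).toNat) (by omega), sub_add_cancel]
  rw [show (M + 1 - i - 1 : ℤ) = M - i by ring] at h_pascal
  simp only [thetaCoeff, Nat.cast_succ, Nat.succ_add, ← add_sub_assoc,
    show (M - (i - 1) : ℤ) = M + 1 - i by ring]
  linear_combination thetaSeq q i * h_pascal +
    qPoch q (M + N) * invQPoch q (N + i - 1) * h_theta

lemma thetaCoeff_succ_right (M N : ℕ) (i : ℤ) :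
    thetaCoeff q M (N + 1) i = thetaCoeff q M N i - q ^ (N + 1) * thetaCoeff q M N (i + 1) := by
  have h_pascal := qPoch_succ_mul_invQPoch_mul_invQPoch hq (n := M + N) (p := N + 1 + i)
    (r := M - i) (by push_cast; ring)
  have h_theta : q ^ (N + 1 + i : ℤ).toNat * thetaSeq q i * invQPoch q (N + 1 + i) =
      -(q ^ (N + 1) * thetaSeq q (i + 1)) * invQPoch q (N + 1 + i) := by
    rcases lt_or_ge (N + 1 + i : ℤ) 0 with hi | hi
    · simp [invQPoch_of_neg q hi]
    · rw [pow_mul_thetaSeq_succ q (B := (N + 1 + i : ℤ).toNat) (by push_cast; omega), neg_neg]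
  rw [show (N + 1 + i - 1 : ℤ) = N + i by ring] at h_pascal
  simp only [thetaCoeff, Nat.cast_succ, ← Nat.add_assoc, sub_add_eq_sub_sub,
    show (N + (i + 1) : ℤ) = N + 1 + i by ring]
  linear_combination thetaSeq q i * h_pascal +
    qPoch q (M + N) * invQPoch q (M - i - 1) * h_theta

lemma tendsto_invQPoch : Tendsto (invQPoch q) atTop (𝓝 (qPochInf q)⁻¹) := by
  rw [← Nat.map_cast_int_atTop, tendsto_map'_iff]
  exact ((tendsto_qPoch hq).inv₀ (qPochInf_ne_zero hq)).congr fun n => (invQPoch_natCast q n).symm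

lemma tendsto_thetaCoeff (i : ℤ) : Tendsto (fun N => thetaCoeff q (N + 1) N i) atTop
    (𝓝 (thetaSeq q i * (qPochInf q)⁻¹)) := by
  have h_left : Tendsto (fun N : ℕ => ((N + 1 : ℕ) : ℤ) - i) atTop atTop :=
    tendsto_atTop_add_const_right _ _ (tendsto_natCast_atTop_atTop.comp (tendsto_add_atTop_nat 1))
  have h_right : Tendsto (fun N : ℕ => (N : ℤ) + i) atTop atTop :=
    tendsto_atTop_add_const_right _ _ tendsto_natCast_atTop_atTop
  have h_qPoch : Tendsto (fun N => qPoch q (N + 1 + N)) atTop (𝓝 (qPochInf q)) :=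
    (tendsto_qPoch hq).comp <| tendsto_atTop_mono (fun N => Nat.le_add_left N (N + 1)) tendsto_id
  simpa only [thetaCoeff, Function.comp_def, mul_inv_cancel_right₀ (qPochInf_ne_zero hq)] using
    ((h_qPoch.const_mul (thetaSeq q i)).mul ((tendsto_invQPoch hq).comp h_left)).mul
      ((tendsto_invQPoch hq).comp h_right)

lemma qConv_thetaSeq {n i : ℕ} (hi : i < n) :
    qConv q n (fun k _ => thetaSeq q ((k : ℤ) - i)) = 0 := by
  induction n generalizing i with
  | zero => omega
  | succ n ih =>
    have h_pascal := one_sub_pow_mul_qConv_succ hq n fun k _ => thetaSeq q ((k : ℤ) - i)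
    have h_shift : qConv q n (fun k _ => thetaSeq q ((k + 1 : ℕ) - i : ℤ) +
          q ^ k * thetaSeq q ((k : ℤ) - i)) =
        (1 - q ^ i) * qConv q n fun k _ => thetaSeq q ((k : ℤ) - i + 1) := by
      rw [← qConv_const_mul]
      refine qConv_congr q fun k l _ => ?_
      rw [Nat.cast_succ, add_sub_right_comm]
      linear_combination pow_mul_thetaSeq_succ q (A := i) (B := k) (i := (k : ℤ) - i) (by omega)
    have h_zero : (1 - q ^ i) * qConv q n (fun k _ => thetaSeq q ((k : ℤ) - i + 1)) = 0 := by
      cases i with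
      | zero => simp
      | succ i => simpa [← sub_sub] using Or.inr (ih (i := i) (by omega))
    rw [h_shift, h_zero] at h_pascal
    exact (mul_eq_zero.1 h_pascal).resolve_left (one_sub_pow_pos hq n.succ_ne_zero).ne'

end Theta

/-! ### Fourier coefficients of the continuous `q`-Hermite weight -/

section Fourier

open Filter MeasureTheory Real
open scoped Topology

/-- The partial products of the weight function of the continuous `q`-Hermite polynomials. -/
noncomputable def weightPartial (q : ℝ) (N : ℕ) (θ : ℝ) : ℝ :=
  ∏ k ∈ Finset.range N, sqDist (q ^ k) (2 * θ)

/-- The Fourier coefficients of the partial products `weightPartial`. -/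
noncomputable def weightFourier (q : ℝ) (N : ℕ) (j : ℤ) : ℝ :=
  ∫ θ in (0 : ℝ)..2 * π, weightPartial q N θ * cos (j * θ)

section

variable (q : ℝ)

lemma continuous_weightPartial (N : ℕ) : Continuous (weightPartial q N) := by
  unfold weightPartial sqDist
  fun_prop

lemma weightFourier_zero (j : ℤ) : weightFourier q 0 j = if j = 0 then 2 * π else 0 := by
  simp only [weightFourier, weightPartial, Finset.range_zero, Finset.prod_empty, one_mul]
  split_ifs with hj
  · simp [hj]
  · have h_sin : sin (j * (2 * π)) = 0 := sin_eq_zero_iff.2 ⟨j * 2, by push_cast; ring⟩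
    rw [intervalIntegral.integral_comp_mul_left cos (Int.cast_ne_zero.2 hj), integral_cos, h_sin]
    simp

lemma weightFourier_succ (N : ℕ) (j : ℤ) :
    weightFourier q (N + 1) j = (1 + (q ^ N) ^ 2) * weightFourier q N j -
      q ^ N * (weightFourier q N (j + 2) + weightFourier q N (j - 2)) := by
  have h_int (j : ℤ) : IntervalIntegrable (fun θ => weightPartial q N θ * cos (j * θ))
      volume 0 (2 * π) :=
    ((continuous_weightPartial q N).mul (by fun_prop)).intervalIntegrable _ _
  simp only [weightFourier]
  rw [← intervalIntegral.integral_add (h_int _) (h_int _), ← intervalIntegral.integral_const_mul,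
    ← intervalIntegral.integral_const_mul, ← intervalIntegral.integral_sub
      ((h_int j).const_mul _) (((h_int _).add (h_int _)).const_mul _)]
  refine intervalIntegral.integral_congr fun θ _ => ?_
  have h_cos : cos ((j + 2 : ℤ) * θ) + cos ((j - 2 : ℤ) * θ) = 2 * cos (2 * θ) * cos (j * θ) := by
    push_cast
    rw [add_mul, sub_mul, cos_add, cos_sub]
    ring
  simp only [weightPartial, Finset.prod_range_succ]
  rw [sqDist]
  linear_combination (q ^ N * ∏ k ∈ Finset.range N, sqDist (q ^ k) (2 * θ)) * h_cos

lemma weightFourier_odd (N : ℕ) (i : ℤ) : weightFourier q N (2 * i + 1) = 0 := by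
  induction N generalizing i with
  | zero => rw [weightFourier_zero, if_neg (by omega)]
  | succ N ih =>
    rw [weightFourier_succ, show 2 * i + 1 + 2 = 2 * (i + 1) + 1 by ring,
      show 2 * i + 1 - 2 = 2 * (i - 1) + 1 by ring, ih, ih, ih]
    ring

lemma weightFourier_zero_even (i : ℤ) :
    weightFourier q 0 (2 * i) = 2 * π * thetaCoeff q 0 0 i := by
  rw [weightFourier_zero, thetaCoeff]
  rcases lt_trichotomy i 0 with hi | rfl | hi
  · rw [if_neg (by omega), invQPoch_of_neg q (k := (0 : ℕ) + i) (by simpa)]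
    ring
  · simp [invQPoch, thetaSeq]
  · rw [if_neg (by omega), invQPoch_of_neg q (k := (0 : ℕ) - i) (by simpa)]
    ring

end

variable {q : ℝ} (hq : |q| < 1)
include hq

/-- With `w = e ^ (2 i θ)`, the partial product with `N + 1` factors is `1 - w⁻¹` times a finite
theta product in `w`. -/
lemma weightFourier_even (N : ℕ) (i : ℤ) : weightFourier q (N + 1) (2 * i) =
    2 * π * (thetaCoeff q (N + 1) N i - thetaCoeff q (N + 1) N (i + 1)) := by
  induction N generalizing i with
  | zero =>
    rw [weightFourier_succ, show 2 * i + 2 = 2 * (i + 1) by ring,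
      show 2 * i - 2 = 2 * (i - 1) by ring]
    simp only [weightFourier_zero_even, thetaCoeff_succ_left hq, add_sub_cancel_right]
    ring
  | succ N ih =>
    rw [weightFourier_succ, show 2 * i + 2 = 2 * (i + 1) by ring,
      show 2 * i - 2 = 2 * (i - 1) by ring, ih, ih, ih]
    simp only [thetaCoeff_succ_left hq (N + 1) (N + 1), thetaCoeff_succ_right hq (N + 1) N,
      add_sub_cancel_right, sub_add_cancel]
    ring

lemma exists_abs_weightPartial_le : ∃ C, ∀ N θ, |weightPartial q N θ| ≤ C := by
  have h_summable := (summable_geometric_of_lt_one (abs_nonneg q) hq).mul_left 2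
  refine ⟨exp (∑' k : ℕ, 2 * |q| ^ k), fun N θ => ?_⟩
  rw [weightPartial, Finset.abs_prod]
  calc ∏ k ∈ Finset.range N, |sqDist (q ^ k) (2 * θ)|
      ≤ ∏ k ∈ Finset.range N, exp (2 * |q| ^ k) := by
        gcongr with k
        calc |sqDist (q ^ k) (2 * θ)| ≤ (1 + |q ^ k|) ^ 2 := abs_sqDist_le _ _
          _ ≤ exp (|q| ^ k) ^ 2 := by
            rw [abs_pow, add_comm]
            gcongr
            exact add_one_le_exp _
          _ = exp (2 * |q| ^ k) := by rw [← exp_nat_mul, Nat.cast_ofNat]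
    _ = exp (∑ k ∈ Finset.range N, 2 * |q| ^ k) := (exp_sum _ _).symm
    _ ≤ _ := exp_le_exp.2 (h_summable.sum_le_tsum _ fun _ _ => by positivity)

lemma tendsto_weightFourier (j : ℤ) : Tendsto (fun N => weightFourier q N j) atTop
    (𝓝 (∫ θ in (0 : ℝ)..2 * π, sqProd q 1 (2 * θ) * cos (j * θ))) := by
  obtain ⟨C, hC⟩ := exists_abs_weightPartial_le hq
  refine intervalIntegral.tendsto_integral_filter_of_dominated_convergence (fun _ => C)
    (.of_forall fun N => ?_) (.of_forall fun N => .of_forall fun θ _ => ?_)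
    intervalIntegrable_const (.of_forall fun θ _ => ?_)
  · exact ((continuous_weightPartial q N).mul (by fun_prop)).aestronglyMeasurable
  · rw [norm_mul]
    exact (mul_le_of_le_one_right (norm_nonneg _) (abs_cos_le_one _)).trans (hC N θ)
  · simpa only [weightPartial, one_mul] using (tendsto_prod_sqDist hq 1 (2 * θ)).mul_const _

lemma integral_sqProd_mul_cos_odd (i : ℤ) :
    ∫ θ in (0 : ℝ)..2 * π, sqProd q 1 (2 * θ) * cos ((2 * i + 1 : ℤ) * θ) = 0 :=
  tendsto_nhds_unique (tendsto_weightFourier hq _)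
    (tendsto_const_nhds.congr fun N => (weightFourier_odd q N i).symm)

lemma integral_sqProd_mul_cos_even (i : ℤ) :
    ∫ θ in (0 : ℝ)..2 * π, sqProd q 1 (2 * θ) * cos ((2 * i : ℤ) * θ) =
      2 * π * (qPochInf q)⁻¹ * (thetaSeq q i - thetaSeq q (i + 1)) := by
  have h_lim := ((tendsto_thetaCoeff hq i).sub (tendsto_thetaCoeff hq (i + 1))).const_mul (2 * π)
  rw [← sub_mul, mul_comm _ (qPochInf q)⁻¹, ← mul_assoc] at h_lim
  exact tendsto_nhds_unique
    ((tendsto_weightFourier hq _).comp (tendsto_add_atTop_nat 1))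
    (h_lim.congr fun N => (weightFourier_even hq N i).symm)

lemma continuous_sqProd_one : Continuous (sqProd q 1) := by
  have h_inv : Continuous fun θ => (hermiteGen q (q * 1) θ)⁻¹ :=
    (continuous_hermiteGen hq (by simpa)).inv₀ (hermiteGen_ne_zero hq (by simpa))
  rw [funext (sqProd_eq_sqDist_mul_inv hq abs_one.le)]
  unfold sqDist
  fun_prop

lemma integral_sqProd_mul_hermiteFun_eq_qConv (n : ℕ) :
    ∫ θ in (0 : ℝ)..2 * π, sqProd q 1 (2 * θ) * hermiteFun q n θ =
      qConv q n fun k l => ∫ θ in (0 : ℝ)..2 * π,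
        sqProd q 1 (2 * θ) * cos (((k : ℤ) - l : ℤ) * θ) := by
  have h_cont := continuous_sqProd_one hq
  simp only [hermiteFun, qConv, Finset.mul_sum, ← intervalIntegral.integral_const_mul]
  refine (intervalIntegral.integral_finsetSum fun p _ =>
    Continuous.intervalIntegrable (by fun_prop) _ _).trans ?_
  refine Finset.sum_congr rfl fun p _ => intervalIntegral.integral_congr fun θ _ => ?_
  push_cast
  ring

lemma integral_sqProd_mul_hermiteFun_odd (m : ℕ) :
    ∫ θ in (0 : ℝ)..2 * π, sqProd q 1 (2 * θ) * hermiteFun q (2 * m + 1) θ = 0 := by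
  rw [integral_sqProd_mul_hermiteFun_eq_qConv hq, qConv_congr (g := fun _ _ => 0) q fun k l h => ?_]
  · simp [qConv]
  · rw [show (k : ℤ) - l = 2 * (k - m - 1) + 1 by omega, integral_sqProd_mul_cos_odd hq]

lemma integral_sqProd_mul_hermiteFun_even (m : ℕ) :
    ∫ θ in (0 : ℝ)..2 * π, sqProd q 1 (2 * θ) * hermiteFun q (2 * m) θ =
      2 * π * (qPochInf q)⁻¹ * (qConv q (2 * m) (fun k _ => thetaSeq q ((k : ℤ) - m)) -
        qConv q (2 * m) (fun k _ => thetaSeq q ((k : ℤ) - m + 1))) := by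
  rw [integral_sqProd_mul_hermiteFun_eq_qConv hq, ← qConv_sub, ← qConv_const_mul]
  refine qConv_congr q fun k l h => ?_
  rw [show (k : ℤ) - l = 2 * (k - m) by omega, integral_sqProd_mul_cos_even hq]

lemma integral_sqProd_mul_hermiteFun (n : ℕ) :
    ∫ θ in (0 : ℝ)..2 * π, sqProd q 1 (2 * θ) * hermiteFun q n θ =
      if n = 0 then 4 * π * (qPochInf q)⁻¹ else 0 := by
  rcases Nat.even_or_odd' n with ⟨m, rfl | rfl⟩
  · rw [integral_sqProd_mul_hermiteFun_even hq]
    cases m with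
    | zero =>
      simp [thetaSeq]
      ring
    | succ m =>
      have h_shift (k : ℕ) : (k : ℤ) - (m + 1 : ℕ) + 1 = k - m := by push_cast; ring
      simp only [h_shift, qConv_thetaSeq hq (show m + 1 < 2 * (m + 1) by omega),
        qConv_thetaSeq hq (show m < 2 * (m + 1) by omega), sub_zero, mul_zero]
      simp
  · rw [integral_sqProd_mul_hermiteFun_odd hq, if_neg (by omega)]

end Fourier

/-! ### Orthogonality of the continuous big `q`-Hermite polynomials -/

section Moments

open Filter MeasureTheory Real Set

/-- The weight function `|(e ^ (2 i θ); q)_∞ / (β e ^ (i θ); q)_∞| ^ 2` of the continuous big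
`q`-Hermite polynomials. The factors for `k = 0` are split off, so that the definition also makes
sense for `β = ±1`, where `hermiteGen q β` diverges. -/
noncomputable def circleWeight (q β θ : ℝ) : ℝ :=
  4 * (sin θ ^ 2 / sqDist β θ) * hermiteGen q (q * β) θ * (hermiteGen q q (2 * θ))⁻¹

lemma sqDist_eq_sin_sq_add_sq (β θ : ℝ) : sqDist β θ = sin θ ^ 2 + (cos θ - β) ^ 2 := by
  rw [sqDist]
  linear_combination -sin_sq_add_cos_sq θ

lemma sqDist_nonneg (β θ : ℝ) : 0 ≤ sqDist β θ := by
  rw [sqDist_eq_sin_sq_add_sq]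
  positivity

lemma sqDist_pos_of_abs_lt {β : ℝ} (hβ : |β| < 1) (θ : ℝ) : 0 < sqDist β θ := by
  have h_cross : β * cos θ ≤ |β| := (le_abs_self _).trans <| by
    rw [abs_mul]
    exact mul_le_of_le_one_right (abs_nonneg β) (abs_cos_le_one θ)
  calc 0 < (1 - |β|) ^ 2 := pow_pos (sub_pos.2 hβ) 2
    _ = 1 - 2 * |β| + β ^ 2 := by rw [sub_sq, sq_abs]; ring
    _ ≤ sqDist β θ := by rw [sqDist]; linarith

lemma sqDist_pos_of_sin_ne_zero (β : ℝ) {θ : ℝ} (hθ : sin θ ≠ 0) : 0 < sqDist β θ := by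
  rw [sqDist_eq_sin_sq_add_sq]
  positivity

lemma abs_sin_sq_div_sqDist_le_one (β θ : ℝ) : |sin θ ^ 2 / sqDist β θ| ≤ 1 := by
  rw [abs_of_nonneg (div_nonneg (sq_nonneg _) (sqDist_nonneg β θ))]
  refine div_le_one_of_le₀ ?_ (sqDist_nonneg β θ)
  rw [sqDist_eq_sin_sq_add_sq]
  exact le_add_of_nonneg_right (sq_nonneg _)

lemma ae_sin_ne_zero : ∀ᵐ θ : ℝ, sin θ ≠ 0 := by
  have h_countable : {θ : ℝ | sin θ = 0}.Countable :=
    (countable_range fun n : ℤ => (n : ℝ) * π).mono fun _ hθ => sin_eq_zero_iff.1 hθ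
  exact h_countable.ae_notMem volume

variable {q : ℝ} (hq : |q| < 1)
include hq

lemma sqProd_one_two_mul (θ : ℝ) :
    sqProd q 1 (2 * θ) = 4 * sin θ ^ 2 * (hermiteGen q q (2 * θ))⁻¹ := by
  rw [sqProd_eq_sqDist_mul_inv hq abs_one.le, mul_one, sqDist, cos_two_mul, cos_sq']
  ring

lemma circleWeight_eq {β : ℝ} (hβ : |β| < 1) (θ : ℝ) :
    circleWeight q β θ = sqProd q 1 (2 * θ) * hermiteGen q β θ := by
  have h_ne := (sqDist_pos_of_abs_lt hβ θ).ne'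
  rw [circleWeight, sqProd_one_two_mul hq, hermiteGen_mul_left hq hβ]
  field_simp

lemma continuous_inv_hermiteGen_two_mul : Continuous fun θ => (hermiteGen q q (2 * θ))⁻¹ :=
  ((continuous_hermiteGen hq hq).comp (continuous_const_mul 2)).inv₀
    fun _ => hermiteGen_ne_zero hq hq _

lemma measurable_circleWeight {β : ℝ} (hβ : |β| ≤ 1) : Measurable (circleWeight q β) := by
  have h_num := (continuous_hermiteGen hq (abs_mul_lt_one hq hβ)).measurable
  have h_den := (continuous_inv_hermiteGen_two_mul hq).measurable
  unfold circleWeight sqDist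
  fun_prop

lemma exists_abs_circleWeight_le :
    ∃ C, ∀ β, |β| ≤ 1 → ∀ θ ∈ uIoc 0 (2 * π), ‖circleWeight q β θ‖ ≤ C := by
  obtain ⟨C₁, h_num⟩ := exists_abs_hermiteGen_le hq (abs_nonneg q) hq
  obtain ⟨C₂, h_den⟩ := (isCompact_uIcc (a := 0) (b := 2 * π)).exists_bound_of_continuousOn
    (continuous_inv_hermiteGen_two_mul hq).continuousOn
  refine ⟨4 * 1 * C₁ * C₂, fun β hβ θ hθ => ?_⟩
  have h_arg : |q * β| ≤ |q| := by
    rw [abs_mul]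
    exact mul_le_of_le_one_right (abs_nonneg _) hβ
  have hC₁ : 0 ≤ C₁ := (abs_nonneg _).trans (h_num 0 0 (by simp))
  rw [norm_eq_abs, circleWeight, abs_mul, abs_mul, abs_mul, abs_of_pos four_pos]
  gcongr
  exacts [abs_sin_sq_div_sqDist_le_one β θ, h_num θ _ h_arg, h_den θ (uIoc_subset_uIcc hθ)]

lemma intervalIntegrable_circleWeight {β : ℝ} (hβ : |β| ≤ 1) (p : Polynomial ℝ) :
    IntervalIntegrable (fun θ => p.eval (2 * cos θ) * circleWeight q β θ) volume 0 (2 * π) := by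
  obtain ⟨C, hC⟩ := exists_abs_circleWeight_le hq
  refine IntervalIntegrable.continuousOn_mul ?_
    (p.continuous.comp (continuous_cos.const_mul 2)).continuousOn
  refine (intervalIntegrable_const (c := C)).mono_fun'
    (measurable_circleWeight hq hβ).aestronglyMeasurable ?_
  exact (ae_restrict_iff' measurableSet_uIoc).2 (.of_forall (hC β hβ))

/-- Integration against the normalized weight function, as a functional on polynomials in
`2 cos θ`. -/
noncomputable def momentFunctional {β : ℝ} (hβ : |β| ≤ 1) : Polynomial ℝ →ₗ[ℝ] ℝ where
  toFun p := qPochInf q / (4 * π) * ∫ θ in (0 : ℝ)..2 * π, p.eval (2 * cos θ) * circleWeight q β θ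
  map_add' p r := by
    simp only [Polynomial.eval_add, add_mul]
    rw [intervalIntegral.integral_add (intervalIntegrable_circleWeight hq hβ p)
      (intervalIntegrable_circleWeight hq hβ r), mul_add]
  map_smul' t p := by
    simp only [Polynomial.eval_smul, smul_eq_mul, mul_assoc, intervalIntegral.integral_const_mul,
      RingHom.id_apply]
    ring

lemma momentFunctional_apply {β : ℝ} (hβ : |β| ≤ 1) (p : Polynomial ℝ) :
    momentFunctional hq hβ p = qPochInf q / (4 * π) *
      ∫ θ in (0 : ℝ)..2 * π, p.eval (2 * cos θ) * circleWeight q β θ := rfl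

lemma circleWeight_zero (θ : ℝ) : circleWeight q 0 θ = sqProd q 1 (2 * θ) := by
  rw [circleWeight_eq hq (by simp), hermiteGen_zero, mul_one]

lemma momentFunctional_zero_qHermite (n : ℕ) :
    momentFunctional hq (abs_zero.trans_le zero_le_one) (qHermite q n) =
      if n = 0 then 1 else 0 := by
  have h_integrand (θ : ℝ) : (qHermite q n).eval (2 * cos θ) * circleWeight q 0 θ =
      qPoch q n * (sqProd q 1 (2 * θ) * hermiteFun q n θ) := by
    rw [eval_qHermite hq, circleWeight_zero hq]
    ring
  simp only [momentFunctional_apply, h_integrand]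
  rw [intervalIntegral.integral_const_mul, integral_sqProd_mul_hermiteFun hq]
  split_ifs with hn
  · have h_ne := qPochInf_ne_zero hq
    rw [hn, qPoch_zero]
    field_simp
  · simp

lemma momentFunctional_zero_qHermite_mul (i j : ℕ) :
    momentFunctional hq (abs_zero.trans_le zero_le_one) (qHermite q i * qHermite q j) =
      if j = i then qPoch q i else 0 := by
  split_ifs with hij
  · rw [hij]
    exact (threeTermRecurrence_qHermite q).apply_mul_self (momentFunctional_zero_qHermite hq) i
  · exact (threeTermRecurrence_qHermite q).apply_mul_eq_zero (momentFunctional_zero_qHermite hq)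
      (Ne.symm hij)

/-- The expansion of the weight by the generating function, integrated termwise. -/
lemma hasSum_momentFunctional {β : ℝ} (hβ : |β| < 1) (p : Polynomial ℝ) :
    HasSum (fun n => momentFunctional hq (abs_zero.trans_le zero_le_one) (p * qHermite q n) *
      ((qPoch q n)⁻¹ * β ^ n)) (momentFunctional hq hβ.le p) := by
  obtain ⟨u, hu, h_le⟩ := exists_hermiteGen_majorant hq (abs_nonneg β) hβ
  let B (θ : ℝ) : ℝ := p.eval (2 * cos θ) * sqProd q 1 (2 * θ)
  have hB : Continuous B := (p.continuous.comp (by fun_prop)).mul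
    ((continuous_sqProd_one hq).comp (continuous_const_mul 2))
  have h_sum : HasSum (fun n => ∫ θ in (0 : ℝ)..2 * π, B θ * (hermiteFun q n θ * β ^ n))
      (∫ θ in (0 : ℝ)..2 * π, B θ * hermiteGen q β θ) := by
    refine intervalIntegral.hasSum_integral_of_dominated_convergence (fun n θ => |B θ| * u n)
      (fun n => ?_) (fun n => .of_forall fun θ _ => ?_) (.of_forall fun θ _ => hu.mul_left _) ?_
      (.of_forall fun θ _ => (summable_hermiteGen hq hβ θ).hasSum.mul_left _)
    · exact (hB.mul ((continuous_hermiteFun q n).mul continuous_const)).aestronglyMeasurable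
    · rw [norm_mul, norm_eq_abs (B θ)]
      gcongr
      exact h_le n θ β le_rfl
    · simp only [tsum_mul_left]
      exact (hB.abs.mul continuous_const).intervalIntegrable _ _
  have h_term (n : ℕ) (θ : ℝ) : B θ * (hermiteFun q n θ * β ^ n) =
      (p * qHermite q n).eval (2 * cos θ) * circleWeight q 0 θ * ((qPoch q n)⁻¹ * β ^ n) := by
    have h_ne := qPoch_ne_zero hq n
    rw [Polynomial.eval_mul, eval_qHermite hq n, circleWeight_zero hq]
    simp only [B]
    field_simp
  have h_total (θ : ℝ) : B θ * hermiteGen q β θ = p.eval (2 * cos θ) * circleWeight q β θ := by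
    rw [circleWeight_eq hq hβ, ← mul_assoc]
  simp only [h_term, h_total, intervalIntegral.integral_mul_const] at h_sum
  simpa only [momentFunctional_apply, mul_assoc] using h_sum.mul_left (qPochInf q / (4 * π))

lemma momentFunctional_qHermite_of_abs_lt {β : ℝ} (hβ : |β| < 1) (j : ℕ) :
    momentFunctional hq hβ.le (qHermite q j) = β ^ j := by
  refine (hasSum_momentFunctional hq hβ (qHermite q j)).unique ?_
  convert hasSum_ite_eq j (β ^ j) using 2 with n
  rw [momentFunctional_zero_qHermite_mul hq]
  split_ifs with hn
  · rw [hn, mul_inv_cancel_left₀ (qPoch_ne_zero hq j)]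
  · rw [zero_mul]

lemma continuousOn_circleWeight {θ : ℝ} (hθ : sin θ ≠ 0) :
    ContinuousOn (fun β => circleWeight q β θ) (Icc (-1) 1) := by
  have h_gen : ContinuousOn (fun β => hermiteGen q (q * β) θ) (Icc (-1) 1) := by
    refine (continuousOn_hermiteGen hq (abs_nonneg q) hq θ).comp (by fun_prop) fun β hβ => ?_
    rw [mem_Icc, ← abs_le, abs_mul]
    exact mul_le_of_le_one_right (abs_nonneg _) (abs_le.2 hβ)
  have h_quot : ContinuousOn (fun β => sin θ ^ 2 / sqDist β θ) (Icc (-1) 1) :=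
    continuousOn_const.div (by unfold sqDist; fun_prop)
      fun β _ => (sqDist_pos_of_sin_ne_zero β hθ).ne'
  unfold circleWeight
  fun_prop

lemma continuousOn_integral_circleWeight (p : Polynomial ℝ) : ContinuousOn (fun β =>
    ∫ θ in (0 : ℝ)..2 * π, p.eval (2 * cos θ) * circleWeight q β θ) (Icc (-1) 1) := by
  obtain ⟨C, hC⟩ := exists_abs_circleWeight_le hq
  have hp : Continuous fun θ => p.eval (2 * cos θ) :=
    p.continuous.comp (continuous_cos.const_mul 2)
  intro β₀ hβ₀
  have h_near : ∀ᶠ β in nhdsWithin β₀ (Icc (-1) 1), |β| ≤ 1 :=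
    eventually_of_mem self_mem_nhdsWithin fun β hβ => abs_le.2 hβ
  refine intervalIntegral.continuousWithinAt_of_dominated_interval
    (bound := fun θ => |p.eval (2 * cos θ)| * C) (h_near.mono fun β hβ => ?_)
    (h_near.mono fun β hβ => .of_forall fun θ hθ => ?_) ?_ ?_
  · exact (hp.measurable.mul (measurable_circleWeight hq hβ)).aestronglyMeasurable
  · rw [norm_mul, norm_eq_abs]
    gcongr
    exact hC β hβ θ hθ
  · exact (hp.abs.mul continuous_const).intervalIntegrable _ _
  · filter_upwards [ae_sin_ne_zero] with θ hθ _
    exact (continuousOn_circleWeight hq hθ β₀ hβ₀).const_mul _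

lemma momentFunctional_qHermite {β : ℝ} (hβ : |β| ≤ 1) (j : ℕ) :
    momentFunctional hq hβ (qHermite q j) = β ^ j := by
  have h_eqOn : EqOn (fun β => qPochInf q / (4 * π) *
      ∫ θ in (0 : ℝ)..2 * π, (qHermite q j).eval (2 * cos θ) * circleWeight q β θ)
      (fun β => β ^ j) (Icc (-1) 1) :=
    EqOn.of_subset_closure
      (fun β hβ => momentFunctional_qHermite_of_abs_lt hq (abs_lt.2 hβ) j)
      (continuousOn_const.mul (continuousOn_integral_circleWeight hq _))
      (continuous_pow j).continuousOn Ioo_subset_Icc_self (closure_Ioo (by norm_num)).ge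
  exact h_eqOn (abs_le.1 hβ)

lemma momentFunctional_bigQHermite {β : ℝ} (hβ : |β| ≤ 1) (n : ℕ) :
    momentFunctional hq hβ (bigQHermite q β n) = if n = 0 then 1 else 0 :=
  apply_bigQHermite (momentFunctional_qHermite hq hβ) n

end Moments

/-! ### The orthogonality measure of the `q`-Charlier polynomials -/

section Symmetry

open MeasureTheory Real Set

variable {q : ℝ} (hq : |q| < 1)
include hq

lemma hermiteGen_congr {θ θ' : ℝ} (h : cos θ = cos θ') (β : ℝ) :
    hermiteGen q β θ = hermiteGen q β θ' := by
  have h_fun (n : ℕ) : hermiteFun q n θ = hermiteFun q n θ' := by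
    refine mul_left_cancel₀ (qPoch_ne_zero hq n) ?_
    rw [← eval_qHermite hq, ← eval_qHermite hq, h]
  simp only [hermiteGen, h_fun]

lemma circleWeight_two_pi_sub (β θ : ℝ) :
    circleWeight q β (2 * π - θ) = circleWeight q β θ := by
  have h_double : cos (2 * (2 * π - θ)) = cos (2 * θ) := by
    rw [cos_two_mul, cos_two_mul, cos_two_pi_sub]
  rw [circleWeight, circleWeight, sqDist, sqDist, hermiteGen_congr hq (cos_two_pi_sub θ),
    hermiteGen_congr hq h_double, sin_sq, sin_sq, cos_two_pi_sub]

lemma momentFunctional_eq_integral_pi {β : ℝ} (hβ : |β| ≤ 1) (p : Polynomial ℝ) :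
    momentFunctional hq hβ p = qPochInf q / (2 * π) *
      ∫ θ in (0 : ℝ)..π, p.eval (2 * cos θ) * circleWeight q β θ := by
  have h_int := intervalIntegrable_circleWeight hq hβ p
  have h_mem : π ∈ uIcc 0 (2 * π) := by
    rw [uIcc_of_le two_pi_pos.le]
    constructor <;> linarith [pi_pos]
  have h_reflect := intervalIntegral.integral_comp_sub_left (a := 0) (b := π)
    (fun θ => p.eval (2 * cos θ) * circleWeight q β θ) (2 * π)
  simp only [circleWeight_two_pi_sub hq, cos_two_pi_sub, sub_zero,
    show 2 * π - π = π by ring] at h_reflect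
  rw [momentFunctional_apply, ← intervalIntegral.integral_add_adjacent_intervals
    (h_int.mono_set (uIcc_subset_uIcc_left h_mem)) (h_int.mono_set (uIcc_subset_uIcc_right h_mem)),
    ← h_reflect]
  field_simp
  ring

lemma tprod_sqDist_div_sqDist {β θ : ℝ} (hβ : |β| ≤ 1) (hθ : sin θ ≠ 0) :
    ∏' k : ℕ, sqDist (q ^ k) (2 * θ) / sqDist (β * q ^ k) θ = circleWeight q β θ := by
  have h_sqProd := sqProd_eq_sqDist_mul_inv hq hβ θ
  have h_ne : sqProd q β θ ≠ 0 := by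
    rw [h_sqProd]
    exact mul_ne_zero (sqDist_pos_of_sin_ne_zero β hθ).ne'
      (inv_ne_zero (hermiteGen_ne_zero hq (abs_mul_lt_one hq hβ) θ))
  have h_div := (multipliable_sqDist hq 1 (2 * θ)).tprod_div₀ (multipliable_sqDist hq β θ) h_ne
  have h_gen := hermiteGen_ne_zero hq (abs_mul_lt_one hq hβ) θ
  calc ∏' k : ℕ, sqDist (q ^ k) (2 * θ) / sqDist (β * q ^ k) θ
      = sqProd q 1 (2 * θ) / sqProd q β θ := by
        simpa only [sqProd, one_mul] using h_div
    _ = circleWeight q β θ := by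
      rw [sqProd_one_two_mul hq, h_sqProd, circleWeight]
      field_simp

end Symmetry

section ChangeOfVariables

open MeasureTheory Real Set

/-- The parameter of the continuous big `q`-Hermite polynomials that correspond to the
`q`-Charlier polynomials. -/
noncomputable def hermiteParam (a b q : ℝ) : ℝ := -b / √(a * (1 - q))

/-- The point of the support `[A₋, A₊]` with angle `θ`. -/
noncomputable def supportPoint (a b c q θ : ℝ) : ℝ :=
  √(a / (1 - q)) * (2 * cos θ) + (c + b / (1 - q))

/-- The affine substitution that carries `2 cos θ` to the point `supportPoint a b c q θ`. -/
noncomputable def supportSubst (a b c q : ℝ) : Polynomial ℝ :=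
  Polynomial.C √(a / (1 - q)) * Polynomial.X + Polynomial.C (c + b / (1 - q))

lemma charlier_comp_affine {R : Type*} [CommRing R] (a b c q s t : R) (n : ℕ) :
    (charlier (s ^ 2 * a) (s * b) (s * c + t) q n).comp
        (Polynomial.C s * Polynomial.X + Polynomial.C t) = s ^ n • charlier a b c q n := by
  simp only [Polynomial.smul_eq_C_mul]
  induction n using Nat.twoStepInduction with
  | zero => simp [charlier]
  | one =>
    simp [charlier]
    ring
  | more n ih ih' =>
    simp only [charlier, Polynomial.sub_comp, Polynomial.mul_comp, Polynomial.X_comp,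
      Polynomial.C_comp, ih, ih']
    simp only [map_add, map_mul, map_pow]
    ring

lemma eval_comp_supportSubst (a b c q : ℝ) (p : Polynomial ℝ) (θ : ℝ) :
    (p.comp (supportSubst a b c q)).eval (2 * cos θ) = p.eval (supportPoint a b c q θ) := by
  simp [supportSubst, supportPoint]

lemma hasDerivAt_supportPoint (a b c q θ : ℝ) :
    HasDerivAt (supportPoint a b c q) (√(a / (1 - q)) * (2 * -sin θ)) θ :=
  (((hasDerivAt_cos θ).const_mul 2).const_mul _).add_const _

lemma Aminus_le_Aplus (a b c q : ℝ) : Aminus a b c q ≤ Aplus a b c q := by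
  rw [Aminus, Aplus]
  linarith [sqrt_nonneg (a / (1 - q))]

variable {a b c q : ℝ} (ha : 0 < a) (hq₁ : q < 1)
include ha hq₁

lemma sqrt_div_one_sub_pos : 0 < √(a / (1 - q)) :=
  sqrt_pos.2 (div_pos ha (sub_pos.2 hq₁))

lemma sqrt_mul_one_sub : √(a * (1 - q)) = √(a / (1 - q)) * (1 - q) := by
  have h_pos : 0 < 1 - q := sub_pos.2 hq₁
  rw [show a * (1 - q) = a / (1 - q) * (1 - q) ^ 2 by field_simp, sqrt_mul (by positivity),
    sqrt_sq h_pos.le]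

lemma abs_hermiteParam_le_one (hb : b ^ 2 ≤ a * (1 - q)) : |hermiteParam a b q| ≤ 1 := by
  rw [hermiteParam, abs_div, abs_neg, abs_of_nonneg (sqrt_nonneg _),
    div_le_one (sqrt_pos.2 (mul_pos ha (sub_pos.2 hq₁)))]
  exact abs_le_sqrt hb

lemma charlier_comp_supportSubst (n : ℕ) :
    (charlier a b c q n).comp (supportSubst a b c q) =
      √(a / (1 - q)) ^ n • bigQHermite q (hermiteParam a b q) n := by
  have h_pos : 0 < 1 - q := sub_pos.2 hq₁
  have h_a : √(a / (1 - q)) ^ 2 * (1 - q) = a := by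
    rw [sq_sqrt (by positivity)]
    field_simp
  have h_b : √(a / (1 - q)) * (-hermiteParam a b q * (1 - q)) = b := by
    rw [hermiteParam, sqrt_mul_one_sub ha hq₁]
    field_simp
  have h_c : √(a / (1 - q)) * hermiteParam a b q + (c + b / (1 - q)) = c := by
    rw [hermiteParam, sqrt_mul_one_sub ha hq₁]
    field_simp
    ring
  rw [← charlier_comp_affine _ _ _ _ _ (c + b / (1 - q)), h_a, h_b, h_c, supportSubst]

lemma v₁_supportPoint (θ : ℝ) : v₁ a b c q (supportPoint a b c q θ) = cos θ := by
  have h_sqrt := sqrt_div_one_sub_pos ha hq₁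
  rw [v₁, supportPoint, ← inv_div a, sqrt_inv]
  field_simp
  ring

lemma u₁_eq (x : ℝ) : u₁ a b c q x = 2 * v₁ a b c q x ^ 2 - 1 := by
  have h_pos : 0 < 1 - q := sub_pos.2 hq₁
  rw [v₁, mul_pow, mul_pow, sq_sqrt (by positivity), u₁]
  field_simp
  ring

lemma image_supportPoint :
    supportPoint a b c q '' Icc 0 π = Icc (Aminus a b c q) (Aplus a b c q) := by
  have h_comp : supportPoint a b c q =
      (fun y => 2 * √(a / (1 - q)) * y + (c + b / (1 - q))) ∘ cos := by
    funext θ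
    rw [supportPoint, Function.comp_apply]
    ring
  rw [h_comp, image_comp, bijOn_cos.image_eq,
    image_affine_Icc' (mul_pos two_pos (sqrt_div_one_sub_pos ha hq₁)), Aminus, Aplus]
  congr 1 <;> ring

lemma injOn_supportPoint : InjOn (supportPoint a b c q) (Icc 0 π) := fun _ hx _ hy hxy =>
  injOn_cos hx hy <| mul_left_cancel₀ two_ne_zero <|
    mul_left_cancel₀ (sqrt_div_one_sub_pos ha hq₁).ne' (add_right_cancel hxy)

variable (hq₀ : -1 < q) (hb : b ^ 2 ≤ a * (1 - q))
include hq₀ hb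

lemma density_supportPoint {θ : ℝ} (hθ : 0 < sin θ) :
    density a b c q (supportPoint a b c q θ) = qPochInf q / (2 * π) * (1 / 2) *
      (√(a / (1 - q)))⁻¹ * circleWeight q (hermiteParam a b q) θ / sin θ := by
  have h_sq : √(a * (1 - q)) ^ 2 = a * (1 - q) :=
    sq_sqrt (mul_nonneg ha.le (sub_nonneg.2 hq₁.le))
  rw [density, ← tprod_sqDist_div_sqDist (abs_lt.2 ⟨hq₀, hq₁⟩)
    (abs_hermiteParam_le_one ha hq₁ hb) hθ.ne', u₁_eq ha hq₁, v₁_supportPoint ha hq₁,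
    ← cos_two_mul, ← sin_sq, sqrt_sq hθ.le, ← sqrt_inv, inv_div]
  congr 3
  funext k
  rw [sqDist, sqDist, hermiteParam, mul_pow, div_pow, h_sq]
  ring

/-- At the endpoints `θ = 0, π`, where the density divides by zero, both sides vanish. -/
lemma deriv_smul_density (p : Polynomial ℝ) {θ : ℝ} (hθ : θ ∈ Icc 0 π) :
    |√(a / (1 - q)) * (2 * -sin θ)| •
        (p.eval (supportPoint a b c q θ) * density a b c q (supportPoint a b c q θ)) =
      qPochInf q / (2 * π) * ((p.comp (supportSubst a b c q)).eval (2 * cos θ) *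
        circleWeight q (hermiteParam a b q) θ) := by
  rcases (sin_nonneg_of_mem_Icc hθ).eq_or_lt' with h_sin | h_sin
  · simp [h_sin, circleWeight]
  · have h_sqrt := sqrt_div_one_sub_pos ha hq₁
    rw [density_supportPoint ha hq₁ hq₀ hb h_sin, eval_comp_supportSubst, mul_neg, mul_neg,
      abs_neg, abs_of_pos (by positivity), smul_eq_mul]
    field_simp

lemma intervalIntegrable_density (p : Polynomial ℝ) :
    IntervalIntegrable (fun x => p.eval x * density a b c q x) volume
      (Aminus a b c q) (Aplus a b c q) := by
  rw [intervalIntegrable_iff_integrableOn_Icc_of_le (Aminus_le_Aplus a b c q),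
    ← image_supportPoint ha hq₁, integrableOn_image_iff_integrableOn_abs_deriv_smul
      measurableSet_Icc (fun θ _ => (hasDerivAt_supportPoint a b c q θ).hasDerivWithinAt)
      (injOn_supportPoint ha hq₁),
    integrableOn_congr_fun
      (fun θ hθ => deriv_smul_density ha hq₁ hq₀ hb p hθ) measurableSet_Icc]
  have h_int := intervalIntegrable_circleWeight (abs_lt.2 ⟨hq₀, hq₁⟩)
    (abs_hermiteParam_le_one ha hq₁ hb) (p.comp (supportSubst a b c q))
  rw [intervalIntegrable_iff_integrableOn_Icc_of_le two_pi_pos.le] at h_int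
  exact (h_int.mono_set (Icc_subset_Icc_right (by linarith [pi_pos]))).const_mul _

lemma L₁_eval (p : Polynomial ℝ) :
    L₁ a b c q (fun x => p.eval x) =
      momentFunctional (abs_lt.2 ⟨hq₀, hq₁⟩) (abs_hermiteParam_le_one ha hq₁ hb)
        (p.comp (supportSubst a b c q)) := by
  rw [L₁, intervalIntegral.integral_of_le (Aminus_le_Aplus a b c q),
    ← integral_Icc_eq_integral_Ioc, ← image_supportPoint ha hq₁,
    integral_image_eq_integral_abs_deriv_smul
      measurableSet_Icc (fun θ _ => (hasDerivAt_supportPoint a b c q θ).hasDerivWithinAt)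
      (injOn_supportPoint ha hq₁),
    setIntegral_congr_fun measurableSet_Icc
      (fun θ hθ => deriv_smul_density ha hq₁ hq₀ hb p hθ), integral_const_mul,
    momentFunctional_eq_integral_pi, intervalIntegral.integral_of_le pi_pos.le,
    integral_Icc_eq_integral_Ioc]

lemma momentFunctional_charlier_comp_supportSubst (n : ℕ) :
    momentFunctional (abs_lt.2 ⟨hq₀, hq₁⟩) (abs_hermiteParam_le_one ha hq₁ hb)
      ((charlier a b c q n).comp (supportSubst a b c q)) = if n = 0 then 1 else 0 := by
  rw [charlier_comp_supportSubst ha hq₁, map_smul, momentFunctional_bigQHermite]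
  split_ifs with hn <;> simp [hn]

lemma F_eq_L₁ {m : ℕ} (n : Fin m → ℕ) :
    F a b c q n = L₁ a b c q fun x => ∏ j, (charlier a b c q (n j)).eval x := by
  have h_orth : IsOrthogonalityFunctional a b c q
      (momentFunctional (abs_lt.2 ⟨hq₀, hq₁⟩) (abs_hermiteParam_le_one ha hq₁ hb) ∘ₗ
        (Polynomial.aeval (supportSubst a b c q)).toLinearMap) :=
    isOrthogonalityFunctional_iff.2 (momentFunctional_charlier_comp_supportSubst ha hq₁ hq₀ hb)
  simp only [F_eq_apply_prod_charlier h_orth, ← Polynomial.eval_prod, L₁_eval ha hq₁ hq₀ hb]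
  rfl

end ChangeOfVariables

end QCharlier

theorem mainTheorem2 :
    -- any commutative ring of parameters, `L` the orthogonality functional
    (∀ (R : Type*) [CommRing R] (a b c q : R),
      (∃! L : Polynomial R →ₗ[R] R, QCharlier.IsOrthogonalityFunctional a b c q L) ∧
      ∀ L : Polynomial R →ₗ[R] R, QCharlier.IsOrthogonalityFunctional a b c q L →
        ∀ (m : ℕ) (n : Fin m → ℕ), 1 ≤ m →
          QCharlier.F a b c q n = L (∏ j, QCharlier.charlier a b c q (n j))) ∧
    -- real parameters, `L₁` the explicit integral
    (∀ a b c q : ℝ, 0 < a → -1 < q → q < 1 → b ^ 2 ≤ a * (1 - q) →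
      (∀ p : Polynomial ℝ, IntervalIntegrable
        (fun x => p.eval x * QCharlier.density a b c q x) MeasureTheory.volume
        (QCharlier.Aminus a b c q) (QCharlier.Aplus a b c q)) ∧
      ∀ (m : ℕ) (n : Fin m → ℕ), 1 ≤ m →
        QCharlier.F a b c q n =
          QCharlier.L₁ a b c q
            (fun x => ∏ j, (QCharlier.charlier a b c q (n j)).eval x)) := by
  refine ⟨fun R _ a b c q => ⟨QCharlier.existsUnique_isOrthogonalityFunctional a b c q,
      fun L hL m n _ => QCharlier.F_eq_apply_prod_charlier hL n⟩,
    fun a b c q ha hq₀ hq₁ hb => ⟨QCharlier.intervalIntegrable_density ha hq₁ hq₀ hb,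
      fun m n _ => QCharlier.F_eq_L₁ ha hq₁ hq₀ hb n⟩⟩
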